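/- Let $H\in(0,1)$ with $H\neq\frac34$. For $T>0$ let $\mathfrak H=\mathfrak H_T$ be the canonical Hilbert space of fractional Brownian motion with Hurst parameter $H$ on $[0,T]$, i.e. the completion of the real step functions on $[0,T]$ with respect to the (semi-)inner product determined by $$\langle \mathbf 1_{[0,s]},\mathbf 1_{[0,t]}\rangle_{\mathfrak H}=R(s,t)=\tfrac12\big(s^{2H}+t^{2H}-|s-t|^{2H}\big),\qquad s,t\in[0,T],$$ and let $\mathfrak H^{\otimes2}$ be its Hilbert space tensor square. A function $f$ on $[0,T]^2$ is regarded as the element of $\mathfrak H^{\otimes 2}$ determined by $$\langle f,\mathbf 1_{[0,a]}\otimes\mathbf 1_{[0,b]}\rangle_{\mathfrak H^{\otimes2}}=\int_{[0,T]^2} f(u,v)\,\frac{\partial R}{\partial u}(u,a)\,\frac{\partial R}{\partial v}(v,b)\,\mathrm du\,\mathrm dv,\qquad a,b\in[0,T].$$ Let $f_T(t,s)=e^{-|t-s|}\mathbf 1_{\{0\le s,t\le T\}}$ and $$\sigma^2=H^2\,\Gamma(2H)^2\,(4H-1)\Big(1-\frac1{\cos(2H\pi)}\Big),$$ where for $H=\frac14$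 the factor $(4H-1)\big(1-\frac1{\cos(2H\pi)}\big)$ is understood as its limit $\frac2\pi$. Then for every $T>0$ the function $f_T$ defines a unique element of $\mathfrak H^{\otimes2}$, and for every $T_0>0$ there is a constant $C>0$, independent of $T$, such that $$\Big|\frac1{2T}\|f_T\|^2_{\mathfrak H^{\otimes2}}-\sigma^2\Big|\le\frac{C}{T^{\,1\wedge(3-4H)}}\qquad\text{for all }T\ge T_0 .$$ If moreover $H<\frac34$, then $C>0$ can be chosen such that this inequality holds for all $T>0$. -/

import Mathlib

open MeasureTheory Set

open scoped TensorProduct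

noncomputable section

namespace FBM

/-- The covariance function `R(s,t) = (s^{2H} + t^{2H} - |s-t|^{2H}) / 2` of fractional Brownian
motion with Hurst parameter `H`. -/
def cov (H s t : ℝ) : ℝ := (|s| ^ (2 * H) + |t| ^ (2 * H) - |s - t| ^ (2 * H)) / 2

theorem cov_comm (H s t : ℝ) : cov H s t = cov H t s := by
  simp only [cov, abs_sub_comm s t]; ring

/-! ### Positive semidefiniteness of the covariance (needed for the inner product) -/

theorem integrableOn_one_sub_cos (H : ℝ) (h0 : 0 < H) (h1 : H < 1) (t : ℝ) :
    IntegrableOn (fun x : ℝ => (1 - Real.cos (t * x)) * x ^ (-1 - 2 * H)) (Ioi 0) := by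
  have hm : Measurable (fun x : ℝ => (1 - Real.cos (t * x)) * x ^ (-1 - 2 * H)) := by fun_prop
  have hu : Ioi (0 : ℝ) = Ioo 0 1 ∪ Ici 1 := by
    ext x; simp only [mem_Ioi, mem_union, mem_Ioo, mem_Ici]
    constructor
    · intro hx
      rcases lt_or_ge x 1 with h | h
      · exact Or.inl ⟨hx, h⟩
      · exact Or.inr h
    · rintro (h | h)
      · exact h.1
      · linarith
  rw [hu]
  refine IntegrableOn.union ?_ ?_
  · have hi : IntegrableOn (fun x : ℝ => t ^ 2 / 2 * x ^ (1 - 2 * H)) (Ioo 0 1) :=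
      ((intervalIntegral.integrableOn_Ioo_rpow_iff one_pos).2 (by linarith)).const_mul _
    refine Integrable.mono' hi hm.aestronglyMeasurable ?_
    refine (ae_restrict_iff' measurableSet_Ioo).2 (Filter.Eventually.of_forall fun x hx => ?_)
    have hx0 : 0 < x := hx.1
    have hp : 0 ≤ x ^ (-1 - 2 * H) := Real.rpow_nonneg hx0.le _
    have hc := Real.one_sub_sq_div_two_le_cos (x := t * x)
    have hc1 := Real.cos_le_one (t * x)
    rw [Real.norm_of_nonneg (mul_nonneg (by linarith) hp)]
    have he : x ^ (1 - 2 * H) = x ^ 2 * x ^ (-1 - 2 * H) := by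
      rw [← Real.rpow_natCast, ← Real.rpow_add hx0]; congr 1; push_cast; ring
    rw [he, ← mul_assoc]
    refine mul_le_mul_of_nonneg_right ?_ hp
    nlinarith
  · rw [integrableOn_Ici_iff_integrableOn_Ioi]
    have hi : IntegrableOn (fun x : ℝ => 2 * x ^ (-1 - 2 * H)) (Ioi 1) :=
      (integrableOn_Ioi_rpow_of_lt (by linarith) one_pos).const_mul _
    refine Integrable.mono' hi hm.aestronglyMeasurable ?_
    refine (ae_restrict_iff' measurableSet_Ioi).2 (Filter.Eventually.of_forall fun x hx => ?_)
    have hx0 : 0 < x := lt_trans one_pos hx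
    have hp : 0 ≤ x ^ (-1 - 2 * H) := Real.rpow_nonneg hx0.le _
    have hc := Real.neg_one_le_cos (t * x)
    have hc1 := Real.cos_le_one (t * x)
    rw [Real.norm_of_nonneg (mul_nonneg (by linarith) hp)]
    exact mul_le_mul_of_nonneg_right (by linarith) hp

theorem integral_one_sub_cos (H : ℝ) (h0 : 0 < H) (t : ℝ) :
    ∫ x in Ioi (0 : ℝ), (1 - Real.cos (t * x)) * x ^ (-1 - 2 * H) =
      |t| ^ (2 * H) * ∫ x in Ioi (0 : ℝ), (1 - Real.cos x) * x ^ (-1 - 2 * H) := by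
  rcases eq_or_ne t 0 with rfl | ht
  · simp [Real.zero_rpow (by linarith : 2 * H ≠ 0)]
  have hp : 0 < |t| := abs_pos.2 ht
  have h := integral_comp_mul_left_Ioi
    (fun x : ℝ => (1 - Real.cos x) * x ^ (-1 - 2 * H)) 0 hp
  rw [mul_zero, smul_eq_mul] at h
  have h2 : ∫ x in Ioi (0 : ℝ), (1 - Real.cos (|t| * x)) * (|t| * x) ^ (-1 - 2 * H) =
      |t| ^ (-1 - 2 * H) *
        ∫ x in Ioi (0 : ℝ), (1 - Real.cos (t * x)) * x ^ (-1 - 2 * H) := by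
    rw [← integral_const_mul]
    refine setIntegral_congr_fun measurableSet_Ioi fun x hx => ?_
    have hx0 : (0 : ℝ) < x := hx
    have hc : Real.cos (|t| * x) = Real.cos (t * x) := by
      rw [← Real.cos_abs (t * x), abs_mul, abs_of_pos hx0]
    simp only [hc, Real.mul_rpow hp.le hx0.le]; ring
  rw [h2] at h
  have h3 : |t| ^ (1 + 2 * H) * |t| ^ (-1 - 2 * H) = 1 := by
    rw [← Real.rpow_add hp]; ring_nf; exact Real.rpow_zero _
  have h4 : |t| ^ (1 + 2 * H) * |t|⁻¹ = |t| ^ (2 * H) := by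
    rw [← Real.rpow_neg_one, ← Real.rpow_add hp]; congr 1; ring
  calc _ = |t| ^ (1 + 2 * H) * (|t| ^ (-1 - 2 * H) *
        ∫ x in Ioi (0 : ℝ), (1 - Real.cos (t * x)) * x ^ (-1 - 2 * H)) := by
        rw [← mul_assoc, h3, one_mul]
    _ = _ := by rw [h, ← mul_assoc, h4]

theorem integral_one_sub_cos_pos (H : ℝ) (h0 : 0 < H) (h1 : H < 1) :
    0 < ∫ x in Ioi (0 : ℝ), (1 - Real.cos x) * x ^ (-1 - 2 * H) := by
  have hi := integrableOn_one_sub_cos H h0 h1 1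
  simp only [one_mul] at hi
  have hnn : ∀ x ∈ Ioi (0 : ℝ), 0 ≤ (1 - Real.cos x) * x ^ (-1 - 2 * H) := fun x hx =>
    mul_nonneg (by linarith [Real.cos_le_one x]) (Real.rpow_nonneg (le_of_lt hx) _)
  rw [setIntegral_pos_iff_support_of_nonneg_ae
    ((ae_restrict_iff' measurableSet_Ioi).2 (Filter.Eventually.of_forall hnn)) hi]
  have hsub : Ioo (0 : ℝ) 1 ⊆
      Function.support (fun x : ℝ => (1 - Real.cos x) * x ^ (-1 - 2 * H)) ∩ Ioi 0 := by
    intro x hx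
    refine ⟨?_, hx.1⟩
    have hlt : Real.cos x < 1 := by
      have := Real.cos_lt_cos_of_nonneg_of_le_pi le_rfl
        (by linarith [hx.2, Real.pi_gt_three] : x ≤ Real.pi) hx.1
      simpa using this
    exact (mul_pos (by linarith) (Real.rpow_pos_of_pos hx.1 _)).ne'
  refine lt_of_lt_of_le ?_ (measure_mono hsub)
  simp

theorem cov_nonneg (H : ℝ) (h0 : 0 < H) (h1 : H < 1) {ι : Type*} (s : Finset ι)
    (a t : ι → ℝ) : 0 ≤ ∑ i ∈ s, ∑ j ∈ s, a i * a j * cov H (t i) (t j) := by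
  set K := ∫ x in Ioi (0 : ℝ), (1 - Real.cos x) * x ^ (-1 - 2 * H) with hK
  have hKpos : 0 < K := integral_one_sub_cos_pos H h0 h1
  have hint := fun r => integrableOn_one_sub_cos H h0 h1 r
  have key : ∀ r q : ℝ, K * (2 * cov H r q) = ∫ x in Ioi (0 : ℝ),
      ((1 - Real.cos (r * x)) * x ^ (-1 - 2 * H) + (1 - Real.cos (q * x)) * x ^ (-1 - 2 * H)
        - (1 - Real.cos ((r - q) * x)) * x ^ (-1 - 2 * H)) := by
    intro r q
    have hrq : Integrable (fun x : ℝ => (1 - Real.cos (r * x)) * x ^ (-1 - 2 * H) +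
        (1 - Real.cos (q * x)) * x ^ (-1 - 2 * H)) (volume.restrict (Ioi (0 : ℝ))) :=
      (hint r).add (hint q)
    rw [integral_sub hrq (hint (r - q)), integral_add (hint r) (hint q),
      integral_one_sub_cos H h0, integral_one_sub_cos H h0, integral_one_sub_cos H h0, ← hK]
    simp only [cov]; ring
  have hsum : K * 2 * ∑ i ∈ s, ∑ j ∈ s, a i * a j * cov H (t i) (t j) =
      ∫ x in Ioi (0 : ℝ), ∑ i ∈ s, ∑ j ∈ s, a i * a j *
        ((1 - Real.cos (t i * x)) * x ^ (-1 - 2 * H)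
          + (1 - Real.cos (t j * x)) * x ^ (-1 - 2 * H)
          - (1 - Real.cos ((t i - t j) * x)) * x ^ (-1 - 2 * H)) := by
    have hi : ∀ i j, Integrable (fun x : ℝ => a i * a j *
        ((1 - Real.cos (t i * x)) * x ^ (-1 - 2 * H)
          + (1 - Real.cos (t j * x)) * x ^ (-1 - 2 * H)
          - (1 - Real.cos ((t i - t j) * x)) * x ^ (-1 - 2 * H)))
        (volume.restrict (Ioi (0 : ℝ))) := fun i j =>
      (((hint (t i)).add (hint (t j))).sub (hint (t i - t j))).const_mul _
    rw [integral_finsetSum _ (fun i _ => integrable_finsetSum _ fun j _ => hi i j),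
      Finset.mul_sum]
    refine Finset.sum_congr rfl fun i _ => ?_
    rw [integral_finsetSum _ (fun j _ => hi i j), Finset.mul_sum]
    refine Finset.sum_congr rfl fun j _ => ?_
    rw [integral_const_mul, ← key]; ring
  have hnn : 0 ≤ K * 2 * ∑ i ∈ s, ∑ j ∈ s, a i * a j * cov H (t i) (t j) := by
    rw [hsum]
    refine setIntegral_nonneg measurableSet_Ioi fun x hx => ?_
    have he : ∑ i ∈ s, ∑ j ∈ s, a i * a j *
        ((1 - Real.cos (t i * x)) * x ^ (-1 - 2 * H)
          + (1 - Real.cos (t j * x)) * x ^ (-1 - 2 * H)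
          - (1 - Real.cos ((t i - t j) * x)) * x ^ (-1 - 2 * H)) =
        ((∑ i ∈ s, a i * (1 - Real.cos (t i * x))) * (∑ i ∈ s, a i * (1 - Real.cos (t i * x)))
          + (∑ i ∈ s, a i * Real.sin (t i * x)) * (∑ i ∈ s, a i * Real.sin (t i * x)))
            * x ^ (-1 - 2 * H) := by
      rw [Finset.sum_mul_sum, Finset.sum_mul_sum, ← Finset.sum_add_distrib, Finset.sum_mul]
      refine Finset.sum_congr rfl fun i _ => ?_
      rw [← Finset.sum_add_distrib, Finset.sum_mul]
      refine Finset.sum_congr rfl fun j _ => ?_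
      rw [sub_mul (t i), Real.cos_sub]; ring
    rw [he]
    exact mul_nonneg (add_nonneg (mul_self_nonneg _) (mul_self_nonneg _))
      (Real.rpow_nonneg (le_of_lt hx) _)
  exact nonneg_of_mul_nonneg_right hnn (by positivity)

/-! ### The canonical Hilbert space on `[0,T]` and its tensor square -/

/-- Step functions on `[0,T]`: finite linear combinations `∑ᵢ aᵢ 1_[0,tᵢ]`, `tᵢ ∈ [0,T]`, encoded
by their coefficients (`Finsupp.single t 1` stands for `1_[0,t]`). -/
def Step (_H : Ioo (0 : ℝ) 1) (T : ℝ) : Type := Icc (0 : ℝ) T →₀ ℝ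

variable (H : Ioo (0 : ℝ) 1) (T : ℝ)

instance : AddCommGroup (Step H T) := inferInstanceAs (AddCommGroup (Icc (0 : ℝ) T →₀ ℝ))

instance : Module ℝ (Step H T) := inferInstanceAs (Module ℝ (Icc (0 : ℝ) T →₀ ℝ))

/-- The bilinear form on step functions determined by `⟨1_[0,s], 1_[0,t]⟩ = R(s,t)`. -/
def stepForm (x y : Icc (0 : ℝ) T →₀ ℝ) : ℝ :=
  x.sum fun s a => y.sum fun t b => a * b * cov H s t

theorem stepForm_comm (x y : Icc (0 : ℝ) T →₀ ℝ) : stepForm H T y x = stepForm H T x y := by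
  unfold stepForm
  rw [Finsupp.sum_comm]
  refine Finsupp.sum_congr fun s _ => Finsupp.sum_congr fun t _ => ?_
  rw [cov_comm]; ring

theorem stepForm_nonneg (x : Icc (0 : ℝ) T →₀ ℝ) : 0 ≤ stepForm H T x x :=
  cov_nonneg H H.2.1 H.2.2 x.support x (fun s => s)

theorem stepForm_add (x y z : Icc (0 : ℝ) T →₀ ℝ) :
    stepForm H T (x + y) z = stepForm H T x z + stepForm H T y z := by
  unfold stepForm
  refine Finsupp.sum_add_index' (fun s => ?_) (fun s a b => ?_)
  · simp [Finsupp.sum]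
  · simp only [add_mul]; exact Finsupp.sum_add

theorem stepForm_smul (x y : Icc (0 : ℝ) T →₀ ℝ) (r : ℝ) :
    stepForm H T (r • x) y = r * stepForm H T x y := by
  unfold stepForm
  rw [Finsupp.sum_smul_index (fun s => by simp [Finsupp.sum]), Finsupp.mul_sum]
  refine Finsupp.sum_congr fun s _ => ?_
  rw [Finsupp.mul_sum]
  refine Finsupp.sum_congr fun t _ => ?_
  ring

instance stepCore : PreInnerProductSpace.Core ℝ (Step H T) where
  inner x y := stepForm H T x y
  conj_inner_symm x y := stepForm_comm H T x y
  re_inner_nonneg x := stepForm_nonneg H T x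
  add_left x y z := stepForm_add H T x y z
  smul_left x y r := stepForm_smul H T x y r

instance : SeminormedAddCommGroup (Step H T) :=
  InnerProductSpace.Core.toSeminormedAddCommGroup (𝕜 := ℝ)

instance : InnerProductSpace ℝ (Step H T) := InnerProductSpace.ofCore (stepCore H T)

/-- The canonical Hilbert space `𝔥` of fractional Brownian motion on `[0,T]`: the completion of
the step functions for the inner product `⟨1_[0,s], 1_[0,t]⟩ = R(s,t)`. -/
abbrev CanonicalSpace : Type := UniformSpace.Completion (Step H T)

/-- The step function `1_[0,t]`. -/
def stepInd (t : Icc (0 : ℝ) T) : Step H T := Finsupp.single t (1 : ℝ)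

/-- The indicator function `1_[0,t]` as an element of `𝔥`. -/
def ind (t : Icc (0 : ℝ) T) : CanonicalSpace H T :=
  ((stepInd H T t : Step H T) : UniformSpace.Completion (Step H T))

theorem inner_ind (s t : Icc (0 : ℝ) T) :
    inner ℝ (ind H T s) (ind H T t) = cov H s t := by
  refine (UniformSpace.Completion.inner_coe (𝕜 := ℝ) (stepInd H T s) (stepInd H T t)).trans ?_
  change stepForm H T (Finsupp.single s 1) (Finsupp.single t 1) = _
  simp [stepForm]

/-- The Hilbert space tensor product `𝔥^{⊗2}`. -/
abbrev TensorSquare : Type :=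
  UniformSpace.Completion (CanonicalSpace H T ⊗[ℝ] CanonicalSpace H T)

/-- The function `1_[0,a] ⊗ 1_[0,b]` as an element of `𝔥^{⊗2}`. -/
def ind₂ (a b : Icc (0 : ℝ) T) : TensorSquare H T :=
  ((ind H T a ⊗ₜ[ℝ] ind H T b : CanonicalSpace H T ⊗[ℝ] CanonicalSpace H T))

/-- `h ∈ 𝔥^{⊗2}` is the element given by the function `f` on `[0,T]²`: its inner products with
the (total) family `1_[0,a] ⊗ 1_[0,b]` are those of `f`, where
`⟨φ, 1_[0,a]⟩ = ∫_[0,T] φ(u) ∂R/∂u(u,a) du` in each variable. -/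
def IsElement (f : ℝ → ℝ → ℝ) (h : TensorSquare H T) : Prop :=
  ∀ a b : Icc (0 : ℝ) T,
    IntegrableOn (fun p : ℝ × ℝ => f p.1 p.2 * deriv (fun u => cov H u a) p.1 *
      deriv (fun v => cov H v b) p.2) (Icc 0 T ×ˢ Icc 0 T) ∧
    inner ℝ h (ind₂ H T a b) =
      ∫ p in Icc (0 : ℝ) T ×ˢ Icc (0 : ℝ) T, f p.1 p.2 * deriv (fun u => cov H u a) p.1 *
        deriv (fun v => cov H v b) p.2

/-- `f_T(t,s) = e^{-|t-s|} 1_{0 ≤ s,t ≤ T}`. -/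
def fT (T : ℝ) (t s : ℝ) : ℝ :=
  (Icc 0 T ×ˢ Icc 0 T).indicator (fun p : ℝ × ℝ => Real.exp (-|p.1 - p.2|)) (t, s)

/-- `σ_H² = (4H-1)(1 - 1/cos(2Hπ))`, with its limiting value `2/π` at `H = 1/4`. -/
def sigmaHSq (H : ℝ) : ℝ :=
  if H = 1 / 4 then 2 / Real.pi else (4 * H - 1) * (1 - 1 / Real.cos (2 * H * Real.pi))

/-- `σ² = H² Γ(2H)² σ_H²`. -/
def sigmaSq (H : ℝ) : ℝ := H ^ 2 * Real.Gamma (2 * H) ^ 2 * sigmaHSq H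

end FBM

end

/-! The kernel $e^{-|u-v|}$ on $[0,T]^2$ is a superposition of squares. With
$K_r(u)=e^{-(r-u)}\mathbf 1_{u\le r}$ it equals $2\int_0^T K_r(u)K_r(v)\,dr+K_T(u)K_T(v)$
(`integral_expKernel_mul`). Each $K_r\mathbf 1_{[0,r]}$ is an honest vector $x_r$ of $\mathfrak H$,
written without derivatives as $\mathbf 1_{[0,r]}-\int_0^r e^{-(r-u)}\mathbf 1_{[0,u]}\,du$
(`ouCurve`). Hence $f_T=2\int_0^T x_r\otimes x_r\,dr+x_T\otimes x_T$. Uniqueness holds because the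
vectors $\mathbf 1_{[0,a]}\otimes\mathbf 1_{[0,b]}$ are total.

The Gram function $\langle x_t,x_s\rangle$ is the covariance of $Z_t-e^{-t}Z_0$, where $Z$ is the
stationary fractional Ornstein-Uhlenbeck process with covariance $\rho$ = `ouCov` and spectral
density proportional to $\lambda^{1-2H}/(1+\lambda^2)$ (`ouFilter_ouFilter_cov`). So $\|f_T\|^2$ is
a double integral of squared covariances plus boundary terms. Discarding everything that carries a
factor $e^{-t}$ or $e^{-s}$ leaves $8\int_0^T G(r)\,dr$ with $G(r)=\int_0^r\rho^2$, up to
$O(G(T)+\rho(0)^2)$ (`abs_startedEnergy_sub_le`).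

For $H<\frac34$, dividing by $2T$ gives the limit $4\int_0^\infty\rho^2$, which Plancherel, a Beta
integral and the reflection formula identify with $\sigma^2$ (`four_mul_integral_ouCov_sq`). The
rate is that of $\frac1T\int_0^T\int_r^\infty\rho^2\,dx\,dr$ together with $1/T$. Since $\rho$ is an
exponential average of second differences of $|x|^{2H}$, it is $O(x^{2H-2})$ (`abs_ouCov_le`),
whence the exponent $1\wedge(3-4H)$. At $H=\frac12$ this decay would cost a logarithm, but there
$\rho$ decays faster (`abs_ouCov_half_le`). For $T<1$ the crude bound $\|f_T\|^2\le144\,T^{4H}$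
suffices.

For $H>\frac34$ the exponent $3-4H$ is negative, so the claim is only a growth bound:
$\frac1{2T}\|f_T\|^2$ and the constant $\sigma^2$ are both $O(T^{4H-3})$ on $[T_0,\infty)$. -/

noncomputable section

namespace FBM

/-! ### Beta-type integrals on the half-line -/

/-- Subordination: $\Gamma(k)(1+x^2)^{-k}=\int_0^\infty t^{k-1}e^{-t(1+x^2)}\,dt$. Integrating in
$x$ first leaves a Gaussian moment and then a Gamma integral, so this joint integrability yields
both convergence and value of the Beta-type integral. -/
theorem integrable_prod_rpow_mul_exp {a k : ℝ} (ha : -1 < a) (hk : a + 1 < 2 * k) :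
    Integrable (fun p : ℝ × ℝ => p.1 ^ a * (p.2 ^ (k - 1) * Real.exp (-(p.2 * (1 + p.1 ^ 2)))))
      ((volume.restrict (Ioi (0 : ℝ))).prod (volume.restrict (Ioi (0 : ℝ)))) := by
  have hm : Measurable (fun p : ℝ × ℝ =>
      p.1 ^ a * (p.2 ^ (k - 1) * Real.exp (-(p.2 * (1 + p.1 ^ 2))))) := by fun_prop
  have hsplit : ∀ t x : ℝ, x ^ a * (t ^ (k - 1) * Real.exp (-(t * (1 + x ^ 2)))) =
      t ^ (k - 1) * Real.exp (-t) * (x ^ a * Real.exp (-t * x ^ 2)) := by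
    intro t x
    rw [show -(t * (1 + x ^ 2)) = -t + -t * x ^ 2 by ring, Real.exp_add]; ring
  rw [integrable_prod_iff' hm.aestronglyMeasurable]
  constructor
  · refine (ae_restrict_iff' measurableSet_Ioi).2 (Filter.Eventually.of_forall fun t ht => ?_)
    simp only [hsplit]
    exact (integrableOn_rpow_mul_exp_neg_mul_sq ht ha).const_mul _
  · have hi : IntegrableOn (fun t : ℝ => (1 / 2 * Real.Gamma ((a + 1) / 2)) *
        (Real.exp (-t) * t ^ ((k - (a + 1) / 2) - 1))) (Ioi 0) :=
      (Real.GammaIntegral_convergent (by linarith)).const_mul _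
    refine (integrableOn_congr_fun (fun t ht => ?_) measurableSet_Ioi).1 hi
    have ht0 : (0 : ℝ) < t := ht
    have h1 : ∫ x in Ioi (0 : ℝ), ‖x ^ a * (t ^ (k - 1) * Real.exp (-(t * (1 + x ^ 2))))‖ =
        ∫ x in Ioi (0 : ℝ), t ^ (k - 1) * Real.exp (-t) * (x ^ a * Real.exp (-t * x ^ (2 : ℝ))) := by
      refine setIntegral_congr_fun measurableSet_Ioi fun x hx => ?_
      have hx0 : (0 : ℝ) < x := hx
      simp only [Real.rpow_two]
      rw [Real.norm_of_nonneg (by positivity), hsplit]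
    simp only
    rw [h1, integral_const_mul, integral_rpow_mul_exp_neg_mul_rpow two_pos ha ht0,
      show k - (a + 1) / 2 - 1 = (k - 1) + -(a + 1) / 2 by ring, Real.rpow_add ht0]
    ring

theorem integral_rpow_mul_exp_section {k : ℝ} (hk : 0 < k) (a x : ℝ) :
    ∫ t in Ioi (0 : ℝ), x ^ a * (t ^ (k - 1) * Real.exp (-(t * (1 + x ^ 2)))) =
      Real.Gamma k * (x ^ a * (1 + x ^ 2) ^ (-k)) := by
  have h := Real.integral_rpow_mul_exp_neg_mul_Ioi hk (by positivity : 0 < 1 + x ^ 2)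
  rw [integral_const_mul]
  simp only [mul_comm _ (1 + x ^ 2)]
  rw [h, one_div, Real.inv_rpow (by positivity), Real.rpow_neg (by positivity)]
  ring

theorem integrableOn_rpow_mul_one_add_sq {a k : ℝ} (ha : -1 < a) (hk : a + 1 < 2 * k) :
    IntegrableOn (fun x : ℝ => x ^ a * (1 + x ^ 2) ^ (-k)) (Ioi 0) := by
  have hk0 : 0 < k := by linarith
  have h := (integrable_prod_rpow_mul_exp ha hk).integral_prod_left
  simp only [integral_rpow_mul_exp_section hk0] at h
  have h2 := h.const_mul (Real.Gamma k)⁻¹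
  simp only [inv_mul_cancel_left₀ (Real.Gamma_pos_of_pos hk0).ne'] at h2
  exact h2

theorem integral_rpow_mul_one_add_sq {a k : ℝ} (ha : -1 < a) (hk : a + 1 < 2 * k) :
    ∫ x in Ioi (0 : ℝ), x ^ a * (1 + x ^ 2) ^ (-k) =
      Real.Gamma ((a + 1) / 2) * Real.Gamma (k - (a + 1) / 2) / (2 * Real.Gamma k) := by
  have hk0 : 0 < k := by linarith
  have h := integral_integral_swap (f := fun x t : ℝ =>
    x ^ a * (t ^ (k - 1) * Real.exp (-(t * (1 + x ^ 2))))) (integrable_prod_rpow_mul_exp ha hk)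
  simp only [integral_rpow_mul_exp_section hk0] at h
  rw [integral_const_mul] at h
  have h2 : ∫ t in Ioi (0 : ℝ), ∫ x in Ioi (0 : ℝ),
      x ^ a * (t ^ (k - 1) * Real.exp (-(t * (1 + x ^ 2)))) =
      ∫ t in Ioi (0 : ℝ), (1 / 2 * Real.Gamma ((a + 1) / 2)) *
        (Real.exp (-t) * t ^ ((k - (a + 1) / 2) - 1)) := by
    refine setIntegral_congr_fun measurableSet_Ioi fun t ht => ?_
    have ht0 : (0 : ℝ) < t := ht
    have h1 : ∫ x in Ioi (0 : ℝ), x ^ a * (t ^ (k - 1) * Real.exp (-(t * (1 + x ^ 2)))) =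
        ∫ x in Ioi (0 : ℝ), t ^ (k - 1) * Real.exp (-t) * (x ^ a * Real.exp (-t * x ^ (2 : ℝ))) := by
      refine setIntegral_congr_fun measurableSet_Ioi fun x hx => ?_
      simp only [Real.rpow_two]
      rw [show -(t * (1 + x ^ 2)) = -t + -t * x ^ 2 by ring, Real.exp_add]; ring
    rw [h1, integral_const_mul, integral_rpow_mul_exp_neg_mul_rpow two_pos ha ht0,
      show k - (a + 1) / 2 - 1 = (k - 1) + -(a + 1) / 2 by ring, Real.rpow_add ht0]
    ring
  rw [h2, integral_const_mul, ← Real.Gamma_eq_integral (by linarith)] at h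
  have hG := Real.Gamma_pos_of_pos hk0
  rw [eq_div_iff (by positivity)]
  linarith

/-- The weight `λ^{1-2H} / (1 + λ²)`, up to a constant the spectral density of the stationary
fractional Ornstein-Uhlenbeck process. -/
def specWeight (H x : ℝ) : ℝ := x ^ (1 - 2 * H) / (1 + x ^ 2)

theorem specWeight_nonneg (H : ℝ) {x : ℝ} (hx : 0 ≤ x) : 0 ≤ specWeight H x :=
  div_nonneg (Real.rpow_nonneg hx _) (by positivity)

theorem measurable_specWeight (H : ℝ) : Measurable (specWeight H) := by
  unfold specWeight; fun_prop

theorem integrableOn_specWeight {H : ℝ} (h0 : 0 < H) (h1 : H < 1) :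
    IntegrableOn (specWeight H) (Ioi 0) := by
  refine (integrableOn_congr_fun (fun x _ => ?_) measurableSet_Ioi).1
    (integrableOn_rpow_mul_one_add_sq (a := 1 - 2 * H) (k := 1) (by linarith) (by linarith))
  simp only [specWeight, Real.rpow_neg_one, div_eq_mul_inv]

theorem integral_specWeight {H : ℝ} (h0 : 0 < H) (h1 : H < 1) :
    ∫ x in Ioi (0 : ℝ), specWeight H x = Real.pi / (2 * Real.sin (Real.pi * H)) := by
  have h := integral_rpow_mul_one_add_sq (a := 1 - 2 * H) (k := 1) (by linarith) (by linarith)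
  simp only [Real.rpow_neg_one, ← div_eq_mul_inv] at h
  simp only [specWeight]
  rw [h, show (1 - 2 * H + 1) / 2 = 1 - H by ring, show (1 : ℝ) - (1 - H) = H by ring, mul_comm,
    Real.Gamma_mul_Gamma_one_sub, Real.Gamma_one]
  field_simp

theorem specWeight_sq (H : ℝ) {x : ℝ} (hx : 0 < x) :
    specWeight H x ^ 2 = x ^ (2 - 4 * H) * (1 + x ^ 2) ^ (-(2 : ℝ)) := by
  rw [specWeight, div_pow, ← Real.rpow_mul_natCast hx.le, Real.rpow_neg (by positivity),
    Real.rpow_two, div_eq_mul_inv]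
  congr 2; push_cast; ring

theorem integrableOn_specWeight_sq {H : ℝ} (h0 : 0 < H) (h1 : H < 3 / 4) :
    IntegrableOn (fun x => specWeight H x ^ 2) (Ioi 0) :=
  (integrableOn_congr_fun (fun _ hx => (specWeight_sq H hx).symm) measurableSet_Ioi).1
    (integrableOn_rpow_mul_one_add_sq (by linarith) (by linarith))

theorem integral_specWeight_sq {H : ℝ} (h0 : 0 < H) (h1 : H < 3 / 4) :
    ∫ x in Ioi (0 : ℝ), specWeight H x ^ 2 =
      Real.Gamma (3 / 2 - 2 * H) * Real.Gamma (1 / 2 + 2 * H) / 2 := by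
  rw [setIntegral_congr_fun measurableSet_Ioi (fun x hx => specWeight_sq H hx),
    integral_rpow_mul_one_add_sq (by linarith) (by linarith), Real.Gamma_two]
  ring_nf

/-- The constant in the spectral representation of fractional Brownian motion. -/
def specConst (H : ℝ) : ℝ := Real.Gamma (2 * H + 1) * Real.sin (Real.pi * H) / Real.pi

/-- The reflection formula at $2H-\frac12$ turns the Gamma product into $1/\cos(2\pi H)$, and
$\sin^2(\pi H)=\frac12(1-\cos 2\pi H)$ supplies the remaining factor of $\sigma^2$. At $H=\frac14$
reflection meets the pole of $\Gamma$ at $0$, so that case is evaluated directly. -/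
theorem specConst_sq_mul_integral {H : ℝ} (h0 : 0 < H) (h1 : H < 3 / 4) :
    2 * Real.pi * specConst H ^ 2 * ∫ x in Ioi (0 : ℝ), specWeight H x ^ 2 = sigmaSq H := by
  have hpi := Real.pi_pos
  rw [integral_specWeight_sq h0 h1, specConst, Real.Gamma_add_one (by linarith), sigmaSq, sigmaHSq]
  split_ifs with h
  · subst h
    have hs : Real.sin (Real.pi * (1 / 4)) = Real.sqrt 2 / 2 := by
      rw [mul_one_div]; exact Real.sin_pi_div_four
    have h2 : Real.sqrt 2 ^ 2 = 2 := Real.sq_sqrt (by norm_num)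
    rw [hs]
    norm_num [Real.Gamma_one]
    field_simp
    rw [h2]; ring
  · have h4 : 2 * H - 1 / 2 ≠ 0 := fun h' => h (by linarith)
    have hG : Real.Gamma (1 / 2 + 2 * H) = (2 * H - 1 / 2) * Real.Gamma (2 * H - 1 / 2) := by
      rw [← Real.Gamma_add_one h4]; ring_nf
    have hR := Real.Gamma_mul_Gamma_one_sub (2 * H - 1 / 2)
    rw [show (1 : ℝ) - (2 * H - 1 / 2) = 3 / 2 - 2 * H by ring,
      show Real.pi * (2 * H - 1 / 2) = -(Real.pi / 2 - 2 * H * Real.pi) by ring, Real.sin_neg,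
      Real.sin_pi_div_two_sub] at hR
    -- For $0<H<\frac34$ the angle lies in $(0,\frac{3\pi}2)$, where the cosine vanishes only at
    -- $\frac\pi2$, that is at $H=\frac14$.
    have hcos : Real.cos (2 * H * Real.pi) ≠ 0 := by
      rcases lt_or_gt_of_ne h with h' | h'
      · refine (Real.cos_pos_of_mem_Ioo ⟨?_, ?_⟩).ne' <;> nlinarith
      · refine (Real.cos_neg_of_pi_div_two_lt_of_lt ?_ ?_).ne <;> nlinarith
    have hsin : Real.sin (Real.pi * H) ^ 2 = (1 - Real.cos (2 * H * Real.pi)) / 2 := by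
      rw [show 2 * H * Real.pi = 2 * (Real.pi * H) by ring, Real.cos_two_mul, Real.cos_sq']; ring
    rw [hG, show Real.Gamma (3 / 2 - 2 * H) * ((2 * H - 1 / 2) * Real.Gamma (2 * H - 1 / 2)) =
      (2 * H - 1 / 2) * (Real.Gamma (2 * H - 1 / 2) * Real.Gamma (3 / 2 - 2 * H)) by ring, hR,
      div_pow, mul_pow, mul_pow, hsin]
    generalize Real.cos (2 * H * Real.pi) = c at hcos ⊢
    field_simp
    ring

/-! ### The stationary covariance -/

/-- The covariance function of the stationary fractional Ornstein-Uhlenbeck process, in its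
spectral form. -/
def ouCov (H x : ℝ) : ℝ :=
  specConst H * ∫ l in Ioi (0 : ℝ), Real.cos (x * l) * specWeight H l

theorem ouCov_neg (H x : ℝ) : ouCov H (-x) = ouCov H x := by
  simp [ouCov]

theorem ouCov_abs (H x : ℝ) : ouCov H |x| = ouCov H x := by
  rcases abs_choice x with h | h <;> simp only [h, ouCov_neg]

theorem norm_cos_mul_specWeight_le (H x : ℝ) {l : ℝ} (hl : 0 < l) :
    ‖Real.cos (x * l) * specWeight H l‖ ≤ specWeight H l := by
  rw [norm_mul, Real.norm_of_nonneg (specWeight_nonneg H hl.le)]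
  exact mul_le_of_le_one_left (specWeight_nonneg H hl.le) (Real.abs_cos_le_one _)

theorem integrableOn_cos_mul_specWeight {H : ℝ} (h0 : 0 < H) (h1 : H < 1) (x : ℝ) :
    IntegrableOn (fun l => Real.cos (x * l) * specWeight H l) (Ioi 0) := by
  refine Integrable.mono' (integrableOn_specWeight h0 h1) ?_ ?_
  · exact ((by fun_prop : Measurable fun l => Real.cos (x * l)).mul
      (measurable_specWeight H)).aestronglyMeasurable
  · exact (ae_restrict_iff' measurableSet_Ioi).2
      (Filter.Eventually.of_forall fun l hl => norm_cos_mul_specWeight_le H x hl)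

theorem continuous_ouCov {H : ℝ} (h0 : 0 < H) (h1 : H < 1) : Continuous (ouCov H) := by
  refine continuous_const.mul (continuous_of_dominated (bound := specWeight H) ?_ ?_
    (integrableOn_specWeight h0 h1) ?_)
  · exact fun x => (integrableOn_cos_mul_specWeight h0 h1 x).aestronglyMeasurable
  · exact fun x => (ae_restrict_iff' measurableSet_Ioi).2
      (Filter.Eventually.of_forall fun l hl => norm_cos_mul_specWeight_le H x hl)
  · exact Filter.Eventually.of_forall fun l => by fun_prop

theorem specConst_pos {H : ℝ} (h0 : 0 < H) (h1 : H < 1) : 0 < specConst H := by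
  have hs : 0 < Real.sin (Real.pi * H) :=
    Real.sin_pos_of_pos_of_lt_pi (by positivity) (by nlinarith [Real.pi_pos])
  exact div_pos (mul_pos (Real.Gamma_pos_of_pos (by linarith)) hs) Real.pi_pos

/-! ### Exponential averages of trigonometric functions -/

theorem hasDerivAt_exp_neg_mul_trig (l y : ℝ) :
    HasDerivAt (fun y => Real.exp (-y) * (l * Real.sin (l * y) - Real.cos (l * y)) / (1 + l ^ 2))
      (Real.exp (-y) * Real.cos (l * y)) y := by
  have hl : HasDerivAt (fun y => l * y) l y := by simpa using (hasDerivAt_id y).const_mul l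
  have he : HasDerivAt (fun y => Real.exp (-y)) (-Real.exp (-y)) y := by
    simpa using (hasDerivAt_neg y).exp
  have h := ((he.mul ((hl.sin.const_mul l).sub hl.cos)).div_const (1 + l ^ 2))
  refine HasDerivAt.congr_deriv h ?_
  have : (1 + l ^ 2) ≠ 0 := by positivity
  simp only [Pi.sub_apply]
  rw [div_eq_iff this]
  ring

theorem integrableOn_exp_neg_Ioi : IntegrableOn (fun y : ℝ => Real.exp (-y)) (Ioi 0) := by
  simpa using integrableOn_exp_mul_Ioi (a := -1) (by norm_num) 0

theorem integrableOn_exp_neg_mul_cos (l : ℝ) :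
    IntegrableOn (fun y : ℝ => Real.exp (-y) * Real.cos (l * y)) (Ioi 0) := by
  refine Integrable.mono' integrableOn_exp_neg_Ioi
    (by fun_prop : Measurable _).aestronglyMeasurable (Filter.Eventually.of_forall fun y => ?_)
  rw [norm_mul, Real.norm_of_nonneg (Real.exp_pos _).le]
  exact mul_le_of_le_one_right (Real.exp_pos _).le (Real.abs_cos_le_one _)

/-- The factor $l^2/(1+l^2)$ is what turns the density $l^{-1-2H}$ of fractional Brownian motion
into `specWeight`. -/
theorem integral_exp_neg_mul_one_sub_cos (l : ℝ) :
    ∫ y in Ioi (0 : ℝ), Real.exp (-y) * (1 - Real.cos (l * y)) = l ^ 2 / (1 + l ^ 2) := by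
  have hc : ∫ y in Ioi (0 : ℝ), Real.exp (-y) * Real.cos (l * y) = 1 / (1 + l ^ 2) := by
    have ht : Filter.Tendsto (fun y => Real.exp (-y) *
        (l * Real.sin (l * y) - Real.cos (l * y)) / (1 + l ^ 2)) Filter.atTop (nhds 0) := by
      have h0 : Filter.Tendsto (fun y => Real.exp (-y) * ((|l| + 1) / (1 + l ^ 2))) Filter.atTop
          (nhds 0) := by
        simpa using (Real.tendsto_exp_neg_atTop_nhds_zero).mul_const ((|l| + 1) / (1 + l ^ 2))
      refine squeeze_zero_norm (fun y => ?_) h0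
      rw [mul_div_assoc, norm_mul, Real.norm_of_nonneg (Real.exp_pos _).le]
      refine mul_le_mul_of_nonneg_left ?_ (Real.exp_pos _).le
      rw [norm_div, Real.norm_of_nonneg (by positivity : 0 ≤ 1 + l ^ 2)]
      refine div_le_div_of_nonneg_right ?_ (by positivity)
      refine (norm_sub_le _ _).trans (add_le_add ?_ (Real.abs_cos_le_one _))
      rw [norm_mul]
      exact mul_le_of_le_one_right (abs_nonneg l) (Real.abs_sin_le_one _)
    rw [integral_Ioi_of_hasDerivAt_of_tendsto' (fun y _ => hasDerivAt_exp_neg_mul_trig l y)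
      (integrableOn_exp_neg_mul_cos l) ht]
    simp only [mul_zero, Real.sin_zero, Real.cos_zero, neg_zero, Real.exp_zero]
    ring
  simp only [mul_sub, mul_one]
  rw [integral_sub integrableOn_exp_neg_Ioi (integrableOn_exp_neg_mul_cos l), hc,
    integral_exp_neg_Ioi_zero]
  have : (1 + l ^ 2) ≠ 0 := by positivity
  field_simp
  ring

theorem sq_div_mul_rpow (H : ℝ) {l : ℝ} (hl : 0 < l) :
    l ^ 2 / (1 + l ^ 2) * l ^ (-1 - 2 * H) = specWeight H l := by
  rw [specWeight, show (1 : ℝ) - 2 * H = 2 + (-1 - 2 * H) by ring, Real.rpow_add hl, Real.rpow_two]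
  ring

/-! ### The stationary covariance as an average of second differences -/

theorem integrable_prod_exp_mul_one_sub_cos {H : ℝ} (h0 : 0 < H) (h1 : H < 1) :
    Integrable (fun p : ℝ × ℝ => Real.exp (-p.2) * (1 - Real.cos (p.1 * p.2)) * p.1 ^ (-1 - 2 * H))
      ((volume.restrict (Ioi (0 : ℝ))).prod (volume.restrict (Ioi (0 : ℝ)))) := by
  have hm : Measurable (fun p : ℝ × ℝ =>
      Real.exp (-p.2) * (1 - Real.cos (p.1 * p.2)) * p.1 ^ (-1 - 2 * H)) := by fun_prop
  rw [integrable_prod_iff hm.aestronglyMeasurable]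
  constructor
  · refine Filter.Eventually.of_forall fun l => ?_
    have h : IntegrableOn (fun y => Real.exp (-y) * (1 - Real.cos (l * y))) (Ioi 0) := by
      simp only [mul_sub, mul_one]
      exact integrableOn_exp_neg_Ioi.sub (integrableOn_exp_neg_mul_cos l)
    exact h.mul_const (l ^ (-1 - 2 * H))
  · refine (integrableOn_congr_fun (fun l hl => ?_) measurableSet_Ioi).1
      (integrableOn_specWeight h0 h1)
    have hl0 : (0 : ℝ) < l := hl
    rw [← sq_div_mul_rpow H hl0, ← integral_exp_neg_mul_one_sub_cos, ← integral_mul_const]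
    refine setIntegral_congr_fun measurableSet_Ioi fun y hy => ?_
    simp only
    rw [Real.norm_of_nonneg]
    have := Real.cos_le_one (l * y)
    have : 0 ≤ 1 - Real.cos (l * y) := by linarith
    positivity

/-- The symmetric second difference of `|·|^{2H}`. -/
def secondDiff (H x y : ℝ) : ℝ := |x + y| ^ (2 * H) + |x - y| ^ (2 * H) - 2 * |x| ^ (2 * H)

/-- The second difference of $1-\cos(\cdot\,l)$ is again a product of cosines, and
$\int(1-\cos(tl))\,l^{-1-2H}\,dl$ is proportional to $|t|^{2H}$. Grouping into factors $1-\cos$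
keeps every separate integral convergent at $0$. -/
theorem mul_secondDiff {H : ℝ} (h0 : 0 < H) (h1 : H < 1) (x y : ℝ) :
    (∫ l in Ioi (0 : ℝ), (1 - Real.cos l) * l ^ (-1 - 2 * H)) * secondDiff H x y =
      ∫ l in Ioi (0 : ℝ), 2 * Real.cos (x * l) * ((1 - Real.cos (l * y)) * l ^ (-1 - 2 * H)) := by
  have hint := fun r => integrableOn_one_sub_cos H h0 h1 r
  have hs : ∀ l : ℝ, 2 * Real.cos (x * l) * ((1 - Real.cos (l * y)) * l ^ (-1 - 2 * H)) =
      ((1 - Real.cos ((x + y) * l)) * l ^ (-1 - 2 * H) +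
        (1 - Real.cos ((x - y) * l)) * l ^ (-1 - 2 * H)) -
        2 * ((1 - Real.cos (x * l)) * l ^ (-1 - 2 * H)) := by
    intro l
    rw [add_mul x, sub_mul x, Real.cos_add, Real.cos_sub, mul_comm l y]; ring
  simp only [hs]
  have hadd : Integrable (fun l : ℝ => (1 - Real.cos ((x + y) * l)) * l ^ (-1 - 2 * H) +
        (1 - Real.cos ((x - y) * l)) * l ^ (-1 - 2 * H)) (volume.restrict (Ioi (0 : ℝ))) :=
    (hint (x + y)).add (hint (x - y))
  rw [integral_sub hadd ((hint x).const_mul 2), integral_add (hint _) (hint _),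
    integral_const_mul, integral_one_sub_cos H h0, integral_one_sub_cos H h0,
    integral_one_sub_cos H h0, secondDiff]
  ring

theorem integral_exp_mul_secondDiff_aux {H : ℝ} (h0 : 0 < H) (h1 : H < 1) (x : ℝ) :
    (∫ l in Ioi (0 : ℝ), (1 - Real.cos l) * l ^ (-1 - 2 * H)) *
      ∫ y in Ioi (0 : ℝ), Real.exp (-y) * secondDiff H x y =
      2 * ∫ l in Ioi (0 : ℝ), Real.cos (x * l) * specWeight H l := by
  have hF : Integrable (Function.uncurry fun l y : ℝ => 2 * Real.cos (x * l) *
      (Real.exp (-y) * (1 - Real.cos (l * y)) * l ^ (-1 - 2 * H)))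
      ((volume.restrict (Ioi (0 : ℝ))).prod (volume.restrict (Ioi (0 : ℝ)))) := by
    refine Integrable.bdd_mul (c := 2) (integrable_prod_exp_mul_one_sub_cos h0 h1)
      (by fun_prop : Measurable fun p : ℝ × ℝ => 2 * Real.cos (x * p.1)).aestronglyMeasurable
      (Filter.Eventually.of_forall fun p => ?_)
    rw [norm_mul, Real.norm_two]
    linarith [Real.abs_cos_le_one (x * p.1), Real.norm_eq_abs (Real.cos (x * p.1))]
  have h := integral_integral_swap hF
  have hl : ∫ l in Ioi (0 : ℝ), ∫ y in Ioi (0 : ℝ), 2 * Real.cos (x * l) *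
      (Real.exp (-y) * (1 - Real.cos (l * y)) * l ^ (-1 - 2 * H)) =
      2 * ∫ l in Ioi (0 : ℝ), Real.cos (x * l) * specWeight H l := by
    rw [← integral_const_mul]
    refine setIntegral_congr_fun measurableSet_Ioi fun l hl => ?_
    rw [integral_const_mul, integral_mul_const, integral_exp_neg_mul_one_sub_cos,
      sq_div_mul_rpow H hl]
    ring
  have hy : ∫ y in Ioi (0 : ℝ), ∫ l in Ioi (0 : ℝ), 2 * Real.cos (x * l) *
      (Real.exp (-y) * (1 - Real.cos (l * y)) * l ^ (-1 - 2 * H)) =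
      (∫ l in Ioi (0 : ℝ), (1 - Real.cos l) * l ^ (-1 - 2 * H)) *
      ∫ y in Ioi (0 : ℝ), Real.exp (-y) * secondDiff H x y := by
    rw [← integral_const_mul]
    refine setIntegral_congr_fun measurableSet_Ioi fun y _ => ?_
    rw [mul_left_comm, mul_secondDiff h0 h1, ← integral_const_mul]
    congr 1
    ext l
    ring
  rw [← hy, ← hl, h]

/-- The value of the constant in the spectral representation of `|·|^{2H}`. -/
theorem specConst_mul_integral_one_sub_cos {H : ℝ} (h0 : 0 < H) (h1 : H < 1) :
    2 * specConst H * ∫ l in Ioi (0 : ℝ), (1 - Real.cos l) * l ^ (-1 - 2 * H) = 1 := by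
  -- At $x=0$ one side contains the Gamma integral of $y^{2H}$ and the other the integral of
  -- `specWeight`; both are explicit, so the unknown constant can be solved for.
  have h := integral_exp_mul_secondDiff_aux h0 h1 0
  have hG : ∫ y in Ioi (0 : ℝ), Real.exp (-y) * secondDiff H 0 y =
      2 * Real.Gamma (2 * H + 1) := by
    rw [Real.Gamma_eq_integral (by linarith), ← integral_const_mul]
    refine setIntegral_congr_fun measurableSet_Ioi fun y hy => ?_
    have hy0 : (0 : ℝ) < y := hy
    simp only [secondDiff, zero_add, zero_sub, abs_neg, abs_zero, abs_of_pos hy0,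
      Real.zero_rpow (by linarith : 2 * H ≠ 0), add_sub_cancel_right]
    ring
  simp only [zero_mul, Real.cos_zero, one_mul] at h
  rw [hG, integral_specWeight h0 h1] at h
  have hs : 0 < Real.sin (Real.pi * H) :=
    Real.sin_pos_of_pos_of_lt_pi (by positivity) (by nlinarith [Real.pi_pos])
  have hpi := Real.pi_pos
  set K := ∫ l in Ioi (0 : ℝ), (1 - Real.cos l) * l ^ (-1 - 2 * H)
  set G := Real.Gamma (2 * H + 1)
  set S := Real.sin (Real.pi * H)
  rw [specConst, show 2 * (G * S / Real.pi) * K = (K * (2 * G)) * (S / Real.pi) by ring, h]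
  field_simp

/-- This form shows the decay of `ouCov`, which in the spectral form is hidden in the oscillation of
the cosine. -/
theorem ouCov_eq_integral_secondDiff {H : ℝ} (h0 : 0 < H) (h1 : H < 1) (x : ℝ) :
    ouCov H x = 1 / 4 * ∫ y in Ioi (0 : ℝ), Real.exp (-y) * secondDiff H x y := by
  have h := integral_exp_mul_secondDiff_aux h0 h1 x
  have hc := specConst_mul_integral_one_sub_cos h0 h1
  set K := ∫ l in Ioi (0 : ℝ), (1 - Real.cos l) * l ^ (-1 - 2 * H)
  set I := ∫ y in Ioi (0 : ℝ), Real.exp (-y) * secondDiff H x y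
  rw [ouCov, show (∫ l in Ioi (0 : ℝ), Real.cos (x * l) * specWeight H l) = K * I / 2 by linarith]
  calc _ = (2 * specConst H * K) * I / 4 := by ring
    _ = _ := by rw [hc]; ring

/-! ### Decay of the stationary covariance -/

/-- By homogeneity only $z=y/x$ matters. Bernoulli's inequality for the concave power $H$ of $(1\pm
z)^2$ gives the upper bound. For $z^2<1$ the lower bound is the arithmetic-geometric mean
inequality, with $AB=((1-z^2)^2)^H\ge(1-z^2)^2$. No relation between $y$ and $x$ is needed, so the
average over $y$ requires no splitting. -/
theorem abs_secondDiff_le {H : ℝ} (h0 : 0 < H) (h1 : H < 1) {x : ℝ} (hx : 0 < x) (y : ℝ) :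
    |secondDiff H x y| ≤ 2 * y ^ 2 * x ^ (2 * H - 2) := by
  set z := y / x with hz
  have hy : y = x * z := by rw [hz]; field_simp
  have hpow : ∀ w : ℝ, |x * w| ^ (2 * H) = x ^ (2 * H) * (w ^ 2) ^ H := by
    intro w
    rw [abs_mul, abs_of_pos hx, Real.mul_rpow hx.le (abs_nonneg _), ← sq_abs w,
      ← Real.rpow_natCast_mul (abs_nonneg _)]
    norm_num
  have hsd : secondDiff H x y = x ^ (2 * H) * (((1 + z) ^ 2) ^ H + ((1 - z) ^ 2) ^ H - 2) := by
    have e1 := hpow (1 + z)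
    have e2 := hpow (1 - z)
    have e3 := hpow 1
    rw [mul_one, one_pow, Real.one_rpow, mul_one] at e3
    rw [secondDiff, hy, show x + x * z = x * (1 + z) by ring, show x - x * z = x * (1 - z) by ring,
      e1, e2, e3]
    ring
  have hup : ∀ w : ℝ, 0 ≤ w → w ^ H ≤ 1 + H * (w - 1) := by
    intro w hw
    have := rpow_one_add_le_one_add_mul_self (s := w - 1) (by linarith) h0.le h1.le
    rwa [add_sub_cancel] at this
  have hU : ((1 + z) ^ 2) ^ H + ((1 - z) ^ 2) ^ H - 2 ≤ 2 * z ^ 2 := by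
    have a1 := hup _ (sq_nonneg (1 + z))
    have a2 := hup _ (sq_nonneg (1 - z))
    nlinarith [sq_nonneg z]
  have hL : -(2 * z ^ 2) ≤ ((1 + z) ^ 2) ^ H + ((1 - z) ^ 2) ^ H - 2 := by
    have hA := Real.rpow_nonneg (sq_nonneg (1 + z)) H
    have hB := Real.rpow_nonneg (sq_nonneg (1 - z)) H
    set A := ((1 + z) ^ 2) ^ H
    set B := ((1 - z) ^ 2) ^ H
    rcases le_or_gt 1 (z ^ 2) with h | h
    · linarith
    · have hAB : A * B = ((1 - z ^ 2) ^ 2) ^ H := by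
        rw [← Real.mul_rpow (sq_nonneg _) (sq_nonneg _)]; congr 1; ring
      have hge : (1 - z ^ 2) ^ 2 ≤ A * B := by
        rw [hAB]
        refine Real.self_le_rpow_of_le_one (sq_nonneg _) ?_ h1.le
        nlinarith [sq_nonneg z]
      have : 2 * (1 - z ^ 2) ≤ A + B := by
        refine abs_le_of_sq_le_sq' (a := 2 * (1 - z ^ 2)) ?_ (by linarith) |>.2
        nlinarith [sq_nonneg (A - B)]
      linarith
  have hxp : x ^ (2 * H) = x ^ 2 * x ^ (2 * H - 2) := by
    rw [← Real.rpow_two, ← Real.rpow_add hx]; ring_nf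
  rw [hsd, abs_mul, abs_of_pos (Real.rpow_pos_of_pos hx _)]
  calc _ ≤ x ^ (2 * H) * (2 * z ^ 2) :=
        mul_le_mul_of_nonneg_left (abs_le.2 ⟨hL, hU⟩) (Real.rpow_nonneg hx.le _)
    _ = _ := by rw [hxp, hy]; ring

theorem integral_exp_neg_mul_pow (n : ℕ) :
    IntegrableOn (fun y : ℝ => Real.exp (-y) * y ^ n) (Ioi 0) ∧
      ∫ y in Ioi (0 : ℝ), Real.exp (-y) * y ^ n = n.factorial := by
  have h1 := Real.GammaIntegral_convergent (s := (n : ℝ) + 1) (by positivity)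
  have h2 := Real.Gamma_eq_integral (s := (n : ℝ) + 1) (by positivity)
  simp only [add_sub_cancel_right, Real.rpow_natCast] at h1 h2
  exact ⟨h1, by rw [← h2, Real.Gamma_nat_eq_factorial]⟩

/-- The constant is $\frac14\cdot2\cdot2!=1$, from averaging $2y^2x^{2H-2}$ against $e^{-y}$. -/
theorem abs_ouCov_le {H : ℝ} (h0 : 0 < H) (h1 : H < 1) {x : ℝ} (hx : 0 < x) :
    |ouCov H x| ≤ x ^ (2 * H - 2) := by
  obtain ⟨hi, hv⟩ := integral_exp_neg_mul_pow 2
  have h : ‖∫ y in Ioi (0 : ℝ), Real.exp (-y) * secondDiff H x y‖ ≤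
      ∫ y in Ioi (0 : ℝ), (2 * x ^ (2 * H - 2)) * (Real.exp (-y) * y ^ 2) := by
    refine norm_integral_le_of_norm_le (hi.const_mul _) (Filter.Eventually.of_forall fun y => ?_)
    rw [norm_mul, Real.norm_of_nonneg (Real.exp_pos _).le]
    nlinarith [abs_secondDiff_le h0 h1 hx y, Real.exp_pos (-y), Real.norm_eq_abs (secondDiff H x y)]
  rw [integral_const_mul, hv, Real.norm_eq_abs] at h
  rw [ouCov_eq_integral_secondDiff h0 h1, abs_mul, abs_of_pos (by norm_num : (0 : ℝ) < 1 / 4)]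
  norm_num at h ⊢
  linarith

/-- At $H=\frac12$ the second difference is $2(y-x)^+$: it vanishes for $y\le x$, so it is at most
$2y^3/x^2$, and $\frac14\cdot2\cdot3!=3$. Any exponent beyond $-1$ would do; its role is to avoid
the logarithm that the general bound would produce in this case. -/
theorem abs_ouCov_half_le {x : ℝ} (hx : 0 < x) : |ouCov (1 / 2) x| ≤ 3 * x ^ (-(2 : ℝ)) := by
  obtain ⟨hi, hv⟩ := integral_exp_neg_mul_pow 3
  have h : ‖∫ y in Ioi (0 : ℝ), Real.exp (-y) * secondDiff (1 / 2) x y‖ ≤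
      ∫ y in Ioi (0 : ℝ), (2 * x ^ (-(2 : ℝ))) * (Real.exp (-y) * y ^ 3) := by
    refine norm_integral_le_of_norm_le (hi.const_mul _)
      ((ae_restrict_iff' measurableSet_Ioi).2 (Filter.Eventually.of_forall fun y hy => ?_))
    have hy0 : (0 : ℝ) < y := hy
    have hb : |secondDiff (1 / 2) x y| ≤ 2 * x ^ (-(2 : ℝ)) * y ^ 3 := by
      rw [Real.rpow_neg hx.le, Real.rpow_two]
      simp only [secondDiff, show (2 : ℝ) * (1 / 2) = 1 by norm_num, Real.rpow_one]
      rw [abs_of_pos (by linarith : 0 < x + y), abs_of_pos hx]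
      rcases le_or_gt y x with hyx | hyx
      · rw [abs_of_nonneg (by linarith : 0 ≤ x - y)]
        rw [show x + y + (x - y) - 2 * x = 0 by ring, abs_zero]
        positivity
      · rw [abs_of_neg (by linarith : x - y < 0), show x + y + -(x - y) - 2 * x = 2 * (y - x) by ring,
          abs_of_pos (by linarith)]
        rw [show 2 * (x ^ 2)⁻¹ * y ^ 3 = 2 * y ^ 3 / x ^ 2 by ring, le_div_iff₀ (by positivity)]
        nlinarith [mul_pos hy0 (pow_pos hx 2), pow_pos hx 3, mul_self_lt_mul_self hx.le hyx,
          mul_pos hy0 hy0]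
    rw [norm_mul, Real.norm_of_nonneg (Real.exp_pos _).le]
    nlinarith [Real.exp_pos (-y), Real.norm_eq_abs (secondDiff (1 / 2) x y)]
  rw [integral_const_mul, hv, Real.norm_eq_abs] at h
  rw [ouCov_eq_integral_secondDiff (by norm_num) (by norm_num), abs_mul,
    abs_of_pos (by norm_num : (0 : ℝ) < 1 / 4)]
  norm_num [Nat.factorial] at h ⊢
  linarith

theorem abs_ouCov_le_zero {H : ℝ} (h0 : 0 < H) (h1 : H < 1) (x : ℝ) :
    |ouCov H x| ≤ ouCov H 0 := by
  have h : ‖∫ l in Ioi (0 : ℝ), Real.cos (x * l) * specWeight H l‖ ≤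
      ∫ l in Ioi (0 : ℝ), specWeight H l :=
    norm_integral_le_of_norm_le (integrableOn_specWeight h0 h1)
      ((ae_restrict_iff' measurableSet_Ioi).2
        (Filter.Eventually.of_forall fun l hl => norm_cos_mul_specWeight_le H x hl))
  rw [ouCov, ouCov, abs_mul, abs_of_pos (specConst_pos h0 h1)]
  simp only [zero_mul, Real.cos_zero, one_mul]
  exact mul_le_mul_of_nonneg_left h (specConst_pos h0 h1).le

/-! ### Plancherel's theorem for functions in `L¹ ∩ L²` -/

open scoped FourierTransform in
-- The $L^2$ Fourier transform is compared with the integral one by duality. Both are locally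
-- integrable and pair identically with every smooth compactly supported function, once through
-- tempered distributions and once through Fubini.
theorem fourier_toLp_ae_eq {f : ℝ → ℂ} (hf : Integrable f) (hf2 : MemLp f 2) :
    ((𝓕 (hf2.toLp f) : Lp ℂ 2 (volume : Measure ℝ)) : ℝ → ℂ) =ᵐ[volume] 𝓕 f := by
  set g : Lp ℂ 2 (volume : Measure ℝ) := 𝓕 (hf2.toLp f) with hg
  have hcont : Continuous (𝓕 f : ℝ → ℂ) :=
    VectorFourier.fourierIntegral_continuous Real.continuous_fourierChar
      (innerSL ℝ).continuous₂ hf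
  refine ae_eq_of_integral_contDiff_smul_eq ((Lp.memLp g).locallyIntegrable (by norm_num))
    hcont.locallyIntegrable fun φ hφ hφc => ?_
  have hψc : HasCompactSupport (fun x => (φ x : ℂ)) := hφc.comp_left Complex.ofReal_zero
  set ψ : SchwartzMap ℝ ℂ := hψc.toSchwartzMap (Complex.ofRealCLM.contDiff.comp hφ) with hψ
  have hψx : ∀ x, ψ x = (φ x : ℂ) := fun x => rfl
  have h1 : ∫ x, φ x • g x = Lp.toTemperedDistribution g ψ := by
    rw [Lp.toTemperedDistribution_apply]
    simp only [hψx, Complex.real_smul, smul_eq_mul]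
  have h2 : Lp.toTemperedDistribution g ψ =
      Lp.toTemperedDistribution (hf2.toLp f) (𝓕 ψ) := by
    rw [hg, ← Lp.fourier_toTemperedDistribution_eq, TemperedDistribution.fourier_apply]
  have h3 : Lp.toTemperedDistribution (hf2.toLp f) (𝓕 ψ) = ∫ x, f x • (𝓕 (ψ : ℝ → ℂ)) x := by
    rw [Lp.toTemperedDistribution_apply]
    refine integral_congr_ae ?_
    filter_upwards [hf2.coeFn_toLp] with x hx
    rw [hx, SchwartzMap.fourier_coe, smul_eq_mul, smul_eq_mul, mul_comm]
  have h4 : ∫ x, (𝓕 f) x • ψ x = ∫ x, f x • (𝓕 (ψ : ℝ → ℂ)) x :=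
    VectorFourier.integral_fourierIntegral_smul_eq_flip (μ := volume) (ν := volume)
      (L := innerₗ ℝ) Real.continuous_fourierChar (innerSL ℝ).continuous₂ hf
      ψ.integrable |>.trans (by rw [flip_innerₗ]; rfl)
  rw [h1, h2, h3, ← h4]
  refine integral_congr_ae (Filter.Eventually.of_forall fun x => ?_)
  simp only [hψx, Complex.real_smul, smul_eq_mul, mul_comm]

open scoped FourierTransform in
theorem integral_norm_fourier_sq {f : ℝ → ℂ} (hf : Integrable f) (hf2 : MemLp f 2) :
    ∫ x, ‖(𝓕 f) x‖ ^ 2 = ∫ x, ‖f x‖ ^ 2 := by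
  have key : ∀ F : Lp ℂ 2 (volume : Measure ℝ), ∫ x, ‖F x‖ ^ 2 = ‖F‖ ^ 2 := by
    intro F
    have h := L2.inner_def (𝕜 := ℂ) F F
    rw [inner_self_eq_norm_sq_to_K] at h
    simp only [inner_self_eq_norm_sq_to_K] at h
    have h' : ((‖F‖ ^ 2 : ℝ) : ℂ) = ((∫ x, ‖F x‖ ^ 2 : ℝ) : ℂ) := by
      rw [← integral_complex_ofReal]
      push_cast
      exact h
    exact (Complex.ofReal_injective h').symm
  calc ∫ x, ‖(𝓕 f) x‖ ^ 2
      = ∫ x, ‖(𝓕 (hf2.toLp f) : Lp ℂ 2 (volume : Measure ℝ)) x‖ ^ 2 :=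
        integral_congr_ae ((fourier_toLp_ae_eq hf hf2).mono fun x hx => by simp only [hx])
    _ = ‖hf2.toLp f‖ ^ 2 := by rw [key, Lp.norm_fourier_eq]
    _ = ∫ x, ‖f x‖ ^ 2 := by
        rw [← key]
        exact integral_congr_ae (hf2.coeFn_toLp.mono fun x hx => by simp only [hx])

/-! ### The square integral of the stationary covariance -/

theorem integrable_comp_abs_of_integrableOn {f : ℝ → ℝ} (hf : IntegrableOn f (Ioi 0)) :
    Integrable (fun x => f |x|) := by
  have h1 : IntegrableOn (fun x => f |x|) (Ioi 0) :=
    (integrableOn_congr_fun (fun x hx => by simp only [abs_of_pos (mem_Ioi.1 hx)])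
      measurableSet_Ioi).1 hf
  have h2 : IntegrableOn (fun x => f |x|) (Iic 0) := by
    have h3 : IntegrableOn (fun x => f |x|) (Ici 0) := by
      rwa [integrableOn_Ici_iff_integrableOn_Ioi]
    have h4 := h3.comp_neg
    simpa using h4
  rw [← integrableOn_univ, ← Iic_union_Ioi (a := (0 : ℝ))]
  exact h2.union h1

open scoped FourierTransform in
theorem fourier_specWeight {H : ℝ} (h0 : 0 < H) (h1 : H < 1) (w : ℝ) :
    𝓕 (fun l : ℝ => (specWeight H |l| : ℂ)) w =
      ((2 * ∫ l in Ioi (0 : ℝ), Real.cos (2 * Real.pi * w * l) * specWeight H l : ℝ) : ℂ) := by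
  have hi : Integrable (fun l : ℝ => specWeight H |l|) :=
    integrable_comp_abs_of_integrableOn (integrableOn_specWeight h0 h1)
  have hic : Integrable (fun l : ℝ => Real.cos (2 * Real.pi * w * l) * specWeight H |l|) :=
    hi.bdd_mul (c := 1) (by fun_prop : Measurable _).aestronglyMeasurable
      (Filter.Eventually.of_forall fun l => Real.abs_cos_le_one _)
  have his : Integrable (fun l : ℝ => Real.sin (2 * Real.pi * w * l) * specWeight H |l|) :=
    hi.bdd_mul (c := 1) (by fun_prop : Measurable _).aestronglyMeasurable
      (Filter.Eventually.of_forall fun l => Real.abs_sin_le_one _)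
  have hsin : ∫ l : ℝ, Real.sin (2 * Real.pi * w * l) * specWeight H |l| = 0 := by
    have h := integral_neg_eq_self
      (fun l : ℝ => Real.sin (2 * Real.pi * w * l) * specWeight H |l|) volume
    simp only [mul_neg, Real.sin_neg, abs_neg, neg_mul, integral_neg] at h
    linarith
  have hcos : ∫ l : ℝ, Real.cos (2 * Real.pi * w * l) * specWeight H |l| =
      2 * ∫ l in Ioi (0 : ℝ), Real.cos (2 * Real.pi * w * l) * specWeight H l := by
    rw [← integral_comp_abs (f := fun l => Real.cos (2 * Real.pi * w * l) * specWeight H l)]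
    congr 1
    ext l
    rcases abs_choice l with h | h <;> rw [h]
    simp
  rw [Real.fourier_real_eq_integral_exp_smul]
  have he : ∀ l : ℝ, Complex.exp (↑(-2 * Real.pi * l * w) * Complex.I) • (specWeight H |l| : ℂ) =
      ((Real.cos (2 * Real.pi * w * l) * specWeight H |l| : ℝ) : ℂ) -
      Complex.I * ((Real.sin (2 * Real.pi * w * l) * specWeight H |l| : ℝ) : ℂ) := by
    intro l
    rw [Complex.exp_mul_I, ← Complex.ofReal_cos, ← Complex.ofReal_sin,
      show -2 * Real.pi * l * w = -(2 * Real.pi * w * l) by ring, Real.cos_neg, Real.sin_neg,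
      smul_eq_mul]
    push_cast
    ring
  simp only [he]
  rw [integral_sub hic.ofReal (his.ofReal.const_mul _), integral_const_mul,
    integral_complex_ofReal, integral_complex_ofReal, hsin, hcos]
  simp

/-- Up to the constant $2/c$, with $c$ = `specConst H`, the function $w\mapsto\rho(2\pi w)$ is the
Fourier transform of the even extension of `specWeight`, so Plancherel applies. The condition
$H<\frac34$ is square integrability of $l^{1-2H}$ at $0$. -/
theorem four_mul_integral_ouCov_sq {H : ℝ} (h0 : 0 < H) (h1 : H < 3 / 4) :
    4 * ∫ x in Ioi (0 : ℝ), ouCov H x ^ 2 = sigmaSq H := by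
  have hH1 : H < 1 := by linarith
  have hi : Integrable (fun l : ℝ => specWeight H |l|) :=
    integrable_comp_abs_of_integrableOn (integrableOn_specWeight h0 hH1)
  have hi2 : Integrable (fun l : ℝ => specWeight H |l| ^ 2) :=
    integrable_comp_abs_of_integrableOn (f := fun l => specWeight H l ^ 2)
      (integrableOn_specWeight_sq h0 h1)
  have hL : MemLp (fun l : ℝ => (specWeight H |l| : ℂ)) 2 := by
    refine (memLp_two_iff_integrable_sq_norm hi.ofReal.aestronglyMeasurable).2 ?_
    simpa using hi2
  have hif : Integrable (fun l : ℝ => (specWeight H |l| : ℂ)) := hi.ofReal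
  have h := integral_norm_fourier_sq hif hL
  have hc := specConst_pos h0 hH1
  have hpi := Real.pi_pos
  have e1 : ∀ w : ℝ, 2 * ∫ l in Ioi (0 : ℝ), Real.cos (2 * Real.pi * w * l) * specWeight H l =
      2 / specConst H * ouCov H (2 * Real.pi * w) := by
    intro w
    rw [ouCov]
    field_simp
  simp only [fourier_specWeight h0 hH1] at h
  simp only [e1, Complex.norm_real, Real.norm_eq_abs, sq_abs,
    mul_pow] at h
  rw [integral_const_mul,
    Measure.integral_comp_mul_left (fun x => ouCov H x ^ 2) (2 * Real.pi),
    integral_comp_abs (f := fun l => specWeight H l ^ 2)] at h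
  have h5 : ∫ x, ouCov H x ^ 2 = 2 * ∫ x in Ioi (0 : ℝ), ouCov H x ^ 2 := by
    rw [← integral_comp_abs (f := fun x => ouCov H x ^ 2)]
    simp only [ouCov_abs]
  rw [h5, abs_of_pos (by positivity), smul_eq_mul] at h
  rw [← specConst_sq_mul_integral h0 h1]
  field_simp at h
  linarith

/-! ### The Ornstein-Uhlenbeck filter -/

/-- The operator that sends a path `f` with `f 0 = 0` to `t ↦ ∫_0^t e^{-(t-u)} df(u)`, written
without derivatives. -/
def ouFilter (f : ℝ → ℝ) (t : ℝ) : ℝ := f t - ∫ u in (0 : ℝ)..t, Real.exp (-(t - u)) * f u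

theorem ouFilter_const_mul (c : ℝ) (f : ℝ → ℝ) (t : ℝ) :
    ouFilter (fun u => c * f u) t = c * ouFilter f t := by
  simp only [ouFilter, mul_sub, ← intervalIntegral.integral_const_mul]
  congr 2
  ext u
  ring

theorem ouFilter_congr {f g : ℝ → ℝ} {t : ℝ} (ht : 0 ≤ t) (h : ∀ u ∈ Icc 0 t, f u = g u) :
    ouFilter f t = ouFilter g t := by
  rw [ouFilter, ouFilter, h t ⟨ht, le_rfl⟩]
  congr 1
  refine intervalIntegral.integral_congr fun u hu => ?_
  rw [uIcc_of_le ht] at hu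
  simp only [h u hu]

/-- Fubini: the bound $g$, uniform in $u$, dominates on $[0,t]\times(0,\infty)$ because the
exponential factor is at most $1$. -/
theorem ouFilter_integral {F : ℝ → ℝ → ℝ} {g : ℝ → ℝ} {t : ℝ} (ht : 0 ≤ t)
    (hF : Measurable (Function.uncurry F)) (hg : IntegrableOn g (Ioi 0))
    (hb : ∀ u ∈ Icc 0 t, ∀ l ∈ Ioi (0 : ℝ), |F u l| ≤ g l) :
    ouFilter (fun u => ∫ l in Ioi (0 : ℝ), F u l) t =
      ∫ l in Ioi (0 : ℝ), ouFilter (fun u => F u l) t := by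
  have hFm : ∀ u, Measurable (F u) := fun u => hF.comp measurable_prodMk_left
  have hFt : IntegrableOn (F t) (Ioi 0) := Integrable.mono' hg (hFm t).aestronglyMeasurable
    ((ae_restrict_iff' measurableSet_Ioi).2
      (Filter.Eventually.of_forall fun l hl => hb t ⟨ht, le_rfl⟩ l hl))
  have hprod : Integrable (Function.uncurry fun u l => Real.exp (-(t - u)) * F u l)
      ((volume.restrict (uIoc 0 t)).prod (volume.restrict (Ioi (0 : ℝ)))) := by
    have hb1 : Integrable (fun p : ℝ × ℝ => (1 : ℝ) * g p.2)
        ((volume.restrict (uIoc 0 t)).prod (volume.restrict (Ioi (0 : ℝ)))) :=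
      Integrable.mul_prod (f := fun _ : ℝ => (1 : ℝ))
        (integrableOn_const (by rw [uIoc_of_le ht]; simp)) hg
    have hm : Measurable (Function.uncurry fun u l => Real.exp (-(t - u)) * F u l) :=
      (by fun_prop : Measurable fun p : ℝ × ℝ => Real.exp (-(t - p.1))).mul hF
    refine Integrable.mono' hb1 hm.aestronglyMeasurable ?_
    rw [Measure.prod_restrict]
    refine (ae_restrict_iff' (measurableSet_uIoc.prod measurableSet_Ioi)).2
      (Filter.Eventually.of_forall fun p hp => ?_)
    obtain ⟨hp1, hp2⟩ := hp
    rw [uIoc_of_le ht] at hp1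
    have h1 := hb p.1 ⟨hp1.1.le, hp1.2⟩ p.2 hp2
    have h2 : Real.exp (-(t - p.1)) ≤ 1 := Real.exp_le_one_iff.2 (by linarith [hp1.2])
    simp only [Function.uncurry, norm_mul, Real.norm_eq_abs, Real.abs_exp]
    exact mul_le_mul h2 h1 (abs_nonneg _) zero_le_one
  have hswap := intervalIntegral_integral_swap hprod
  have hI : Integrable (fun l => ∫ u in (0 : ℝ)..t, Real.exp (-(t - u)) * F u l)
      (volume.restrict (Ioi (0 : ℝ))) := by
    have h := hprod.integral_prod_right
    simp only [uIoc_of_le ht] at h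
    simp only [intervalIntegral.integral_of_le ht]
    exact h
  simp only [ouFilter]
  rw [integral_sub hFt hI, ← hswap]
  congr 2
  ext u
  rw [integral_const_mul]

theorem hasDerivAt_exp_shift (t u : ℝ) :
    HasDerivAt (fun u => Real.exp (-(t - u))) (Real.exp (-(t - u))) u := by
  have h : HasDerivAt (fun u => -(t - u)) 1 u :=
    ((hasDerivAt_id u).const_sub t).neg.congr_deriv (neg_neg 1)
  exact h.exp.congr_deriv (mul_one _)

theorem hasDerivAt_sin_mul (l u : ℝ) :
    HasDerivAt (fun u => Real.sin (l * u)) (l * Real.cos (l * u)) u := by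
  have h : HasDerivAt (fun u => l * u) l u := by simpa using (hasDerivAt_id u).const_mul l
  simpa [mul_comm] using h.sin

theorem hasDerivAt_cos_mul (l u : ℝ) :
    HasDerivAt (fun u => Real.cos (l * u)) (-(l * Real.sin (l * u))) u := by
  have h : HasDerivAt (fun u => l * u) l u := by simpa using (hasDerivAt_id u).const_mul l
  simpa [mul_comm] using h.cos

/-- The filter applied to `1 - cos (l ·)`. -/
def filterCos (l t : ℝ) : ℝ :=
  (l * Real.sin (l * t) - l ^ 2 * (Real.cos (l * t) - Real.exp (-t))) / (1 + l ^ 2)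

/-- The filter applied to `sin (l ·)`. -/
def filterSin (l t : ℝ) : ℝ :=
  (l ^ 2 * Real.sin (l * t) + l * (Real.cos (l * t) - Real.exp (-t))) / (1 + l ^ 2)

theorem integral_exp_mul_trig (p q l t : ℝ) :
    ∫ u in (0 : ℝ)..t, Real.exp (-(t - u)) *
      (p * (1 - Real.cos (l * u)) + q * Real.sin (l * u)) =
    p * (1 - Real.cos (l * t)) + q * Real.sin (l * t) - (p * filterCos l t + q * filterSin l t) := by
  have hl : (1 + l ^ 2) ≠ 0 := by positivity
  have hd : ∀ u, HasDerivAt (fun u => Real.exp (-(t - u)) *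
      (p * (1 - (Real.cos (l * u) + l * Real.sin (l * u)) / (1 + l ^ 2)) +
        q * ((Real.sin (l * u) - l * Real.cos (l * u)) / (1 + l ^ 2))))
      (Real.exp (-(t - u)) * (p * (1 - Real.cos (l * u)) + q * Real.sin (l * u))) u := by
    intro u
    have hs := hasDerivAt_sin_mul l u
    have hc := hasDerivAt_cos_mul l u
    refine ((hasDerivAt_exp_shift t u).mul
      (((((hc.add (hs.const_mul l)).div_const (1 + l ^ 2)).const_sub 1).const_mul p).add
        (((hs.sub (hc.const_mul l)).div_const (1 + l ^ 2)).const_mul q))).congr_deriv ?_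
    simp only [Pi.add_apply, Pi.sub_apply]
    field_simp
    ring
  rw [intervalIntegral.integral_eq_sub_of_hasDerivAt (fun u _ => hd u)
    ((by fun_prop : Continuous _).intervalIntegrable _ _)]
  simp only [sub_self, neg_zero, Real.exp_zero, mul_zero, Real.cos_zero, Real.sin_zero, filterCos,
    filterSin, sub_zero]
  field_simp
  ring

theorem ouFilter_trig (p q l t : ℝ) :
    ouFilter (fun u => p * (1 - Real.cos (l * u)) + q * Real.sin (l * u)) t =
      p * filterCos l t + q * filterSin l t := by
  rw [ouFilter, integral_exp_mul_trig]; ring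

theorem ouFilter_trig_mul (p q l t m : ℝ) :
    ouFilter (fun u => (p * (1 - Real.cos (l * u)) + q * Real.sin (l * u)) * m) t =
      (p * filterCos l t + q * filterSin l t) * m := by
  simp only [mul_comm _ m]
  rw [ouFilter_const_mul, ouFilter_trig]

/-- In complex form the filter sends $e^{ilu}-1$ to $\frac{il}{1+il}(e^{ilt}-e^{-t})$. The identity
is the real part of the product of this value at $t$ with its conjugate at $s$, and $l^2/(1+l^2)$ is
the squared modulus of the multiplier. -/
theorem filterCos_mul_add (l t s : ℝ) :
    filterCos l t * filterCos l s + filterSin l t * filterSin l s =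
      l ^ 2 / (1 + l ^ 2) * ((Real.cos (l * t) - Real.exp (-t)) * (Real.cos (l * s) - Real.exp (-s))
        + Real.sin (l * t) * Real.sin (l * s)) := by
  have hl : (1 + l ^ 2) ≠ 0 := by positivity
  rw [filterCos, filterCos, filterSin, filterSin]
  field_simp
  ring

/-- The left side is $2-2\cos(la)$, at most both $4$ and $a^2l^2$. Bounding by $l^2/(1+l^2)$ makes
`specWeight` the dominating function after multiplication by $l^{-1-2H}$. -/
theorem trig_sq_le (l a : ℝ) :
    (1 - Real.cos (l * a)) ^ 2 + Real.sin (l * a) ^ 2 ≤ (4 + a ^ 2) * (l ^ 2 / (1 + l ^ 2)) := by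
  have h1 : (1 - Real.cos (l * a)) ^ 2 + Real.sin (l * a) ^ 2 = 2 - 2 * Real.cos (l * a) := by
    rw [Real.sin_sq]; ring
  have h2 := Real.one_sub_sq_div_two_le_cos (x := l * a)
  have h3 := Real.neg_one_le_cos (l * a)
  rw [h1, ← mul_div_assoc, le_div_iff₀ (by positivity)]
  nlinarith [sq_nonneg l]

theorem filter_sq_le (l : ℝ) {t : ℝ} (ht : 0 ≤ t) :
    filterCos l t ^ 2 + filterSin l t ^ 2 ≤ 4 * (l ^ 2 / (1 + l ^ 2)) := by
  have h := filterCos_mul_add l t t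
  have hb : (Real.cos (l * t) - Real.exp (-t)) * (Real.cos (l * t) - Real.exp (-t))
        + Real.sin (l * t) * Real.sin (l * t) ≤ 4 := by
    have h1 := Real.sin_sq_add_cos_sq (l * t)
    have h2 := Real.neg_one_le_cos (l * t)
    have h3 : Real.exp (-t) ≤ 1 := Real.exp_le_one_iff.2 (by linarith)
    have h4 := Real.exp_pos (-t)
    nlinarith
  calc _ = filterCos l t * filterCos l t + filterSin l t * filterSin l t := by ring
    _ ≤ l ^ 2 / (1 + l ^ 2) * 4 := by
        rw [h]; exact mul_le_mul_of_nonneg_left hb (by positivity)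
    _ = _ := by ring

theorem abs_mul_add_mul_le {p q P Q M N w m : ℝ} (hm : 0 ≤ m) (h1 : p ^ 2 + q ^ 2 ≤ M * w)
    (h2 : P ^ 2 + Q ^ 2 ≤ N * w) : |(p * P + q * Q) * m| ≤ (M + N) * (w * m) := by
  have h : |p * P + q * Q| ≤ (M + N) * w := by
    rw [abs_le]
    constructor <;> nlinarith [sq_nonneg (p - P), sq_nonneg (q - Q), sq_nonneg (p + P),
      sq_nonneg (q + Q), sq_nonneg p, sq_nonneg q, sq_nonneg P, sq_nonneg Q]
  rw [abs_mul, abs_of_nonneg hm, ← mul_assoc]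
  exact mul_le_mul_of_nonneg_right h hm

/-- Filtering acts under the spectral integral. The free coefficients $p,q$ allow two uses: first
with the trigonometric pair at $a$, then with the pair already filtered in the other variable. -/
theorem ouFilter_spectral {H : ℝ} (h0 : 0 < H) (h1 : H < 1) {p q : ℝ → ℝ} {M t : ℝ} (ht : 0 ≤ t)
    (hp : Measurable p) (hq : Measurable q)
    (hpq : ∀ l, p l ^ 2 + q l ^ 2 ≤ M * (l ^ 2 / (1 + l ^ 2))) :
    ouFilter (fun u => specConst H * ∫ l in Ioi (0 : ℝ),
      (p l * (1 - Real.cos (l * u)) + q l * Real.sin (l * u)) * l ^ (-1 - 2 * H)) t =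
    specConst H * ∫ l in Ioi (0 : ℝ),
      (p l * filterCos l t + q l * filterSin l t) * l ^ (-1 - 2 * H) := by
  rw [ouFilter_const_mul, ouFilter_integral
    (g := fun l => (M + (4 + t ^ 2)) * (l ^ 2 / (1 + l ^ 2) * l ^ (-1 - 2 * H))) ht]
  · simp only [ouFilter_trig_mul]
  · unfold Function.uncurry
    fun_prop
  · exact ((integrableOn_congr_fun (fun l hl => (sq_div_mul_rpow H hl).symm) measurableSet_Ioi).1
      (integrableOn_specWeight h0 h1)).const_mul _
  · intro u hu l hl
    refine abs_mul_add_mul_le (Real.rpow_nonneg (le_of_lt hl) _) (hpq l)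
      ((trig_sq_le l u).trans ?_)
    have h2 : u ^ 2 ≤ t ^ 2 := pow_le_pow_left₀ hu.1 hu.2 2
    exact mul_le_mul_of_nonneg_right (by linarith) (by positivity)

theorem cov_eq_spectral {H : ℝ} (h0 : 0 < H) (h1 : H < 1) (u a : ℝ) :
    cov H u a = specConst H * ∫ l in Ioi (0 : ℝ),
      ((1 - Real.cos (l * a)) * (1 - Real.cos (l * u)) + Real.sin (l * a) * Real.sin (l * u)) *
        l ^ (-1 - 2 * H) := by
  have hint := fun r => integrableOn_one_sub_cos H h0 h1 r
  have hc := specConst_mul_integral_one_sub_cos h0 h1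
  have hs : ∀ l : ℝ, ((1 - Real.cos (l * a)) * (1 - Real.cos (l * u)) +
      Real.sin (l * a) * Real.sin (l * u)) * l ^ (-1 - 2 * H) =
      ((1 - Real.cos (u * l)) * l ^ (-1 - 2 * H) + (1 - Real.cos (a * l)) * l ^ (-1 - 2 * H))
        - (1 - Real.cos ((u - a) * l)) * l ^ (-1 - 2 * H) := by
    intro l
    rw [sub_mul u, Real.cos_sub, mul_comm l u, mul_comm l a]; ring
  have hadd : Integrable (fun l : ℝ => (1 - Real.cos (u * l)) * l ^ (-1 - 2 * H) +
        (1 - Real.cos (a * l)) * l ^ (-1 - 2 * H)) (volume.restrict (Ioi (0 : ℝ))) :=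
    (hint u).add (hint a)
  simp only [hs]
  rw [integral_sub hadd (hint (u - a)), integral_add (hint _) (hint _),
    integral_one_sub_cos H h0, integral_one_sub_cos H h0, integral_one_sub_cos H h0, cov]
  set K := ∫ l in Ioi (0 : ℝ), (1 - Real.cos l) * l ^ (-1 - 2 * H)
  rw [show specConst H * (|u| ^ (2 * H) * K + |a| ^ (2 * H) * K - |u - a| ^ (2 * H) * K) =
    (2 * specConst H * K) * ((|u| ^ (2 * H) + |a| ^ (2 * H) - |u - a| ^ (2 * H)) / 2) by ring, hc,
    one_mul]

/-- The covariance of `Z_t - e^{-t} Z_0`, where `Z` is a stationary process with covariance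
function `ρ`. -/
def startedCov (ρ : ℝ → ℝ) (t s : ℝ) : ℝ :=
  ρ (t - s) - Real.exp (-s) * ρ t - Real.exp (-t) * ρ s + Real.exp (-t) * Real.exp (-s) * ρ 0

/-- Filtering both variables of the spectral form of `cov` leaves the kernel of `filterCos_mul_add`.
Its expansion has one stationary term and three terms carrying $e^{-s}$, $e^{-t}$ or both, which are
the four terms of `startedCov`. -/
theorem ouFilter_ouFilter_cov {H : ℝ} (h0 : 0 < H) (h1 : H < 1) {t s : ℝ} (ht : 0 ≤ t)
    (hs : 0 ≤ s) :
    ouFilter (fun a => ouFilter (fun u => cov H u a) t) s = startedCov (ouCov H) t s := by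
  have e1 : ∀ a, ouFilter (fun u => cov H u a) t = specConst H * ∫ l in Ioi (0 : ℝ),
      (filterCos l t * (1 - Real.cos (l * a)) + filterSin l t * Real.sin (l * a)) *
        l ^ (-1 - 2 * H) := by
    intro a
    simp only [cov_eq_spectral h0 h1]
    rw [ouFilter_spectral h0 h1 ht (by fun_prop) (by fun_prop) (fun l => trig_sq_le l a)]
    simp only [mul_comm (filterCos _ t), mul_comm (filterSin _ t)]
  simp only [e1]
  rw [ouFilter_spectral h0 h1 hs (by unfold filterCos; fun_prop) (by unfold filterSin; fun_prop)
    (fun l => filter_sq_le l ht)]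
  have e2 : ∀ l ∈ Ioi (0 : ℝ), (filterCos l t * filterCos l s + filterSin l t * filterSin l s) *
      l ^ (-1 - 2 * H) = Real.cos ((t - s) * l) * specWeight H l -
        Real.exp (-s) * (Real.cos (t * l) * specWeight H l) -
        Real.exp (-t) * (Real.cos (s * l) * specWeight H l) +
        Real.exp (-t) * Real.exp (-s) * (Real.cos (0 * l) * specWeight H l) := by
    intro l hl
    rw [filterCos_mul_add, ← sq_div_mul_rpow H hl, sub_mul t, Real.cos_sub, zero_mul,
      Real.cos_zero, mul_comm t l, mul_comm s l]
    ring
  have hi := integrableOn_cos_mul_specWeight h0 h1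
  have i1 := (hi t).const_mul (Real.exp (-s))
  have i2 := (hi s).const_mul (Real.exp (-t))
  have i3 := (hi 0).const_mul (Real.exp (-t) * Real.exp (-s))
  have i4 : Integrable (fun l => Real.cos ((t - s) * l) * specWeight H l -
      Real.exp (-s) * (Real.cos (t * l) * specWeight H l)) (volume.restrict (Ioi 0)) :=
    (hi (t - s)).sub i1
  have i5 : Integrable (fun l => Real.cos ((t - s) * l) * specWeight H l -
      Real.exp (-s) * (Real.cos (t * l) * specWeight H l) -
      Real.exp (-t) * (Real.cos (s * l) * specWeight H l)) (volume.restrict (Ioi 0)) := i4.sub i2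
  rw [setIntegral_congr_fun measurableSet_Ioi e2, integral_add i5 i3, integral_sub i4 i2, integral_sub (hi (t - s)) i1, integral_const_mul,
    integral_const_mul, integral_const_mul, startedCov, ouCov, ouCov, ouCov, ouCov]
  ring

/-! ### The derivative of the covariance function -/

theorem continuous_cov {H : ℝ} (h0 : 0 < H) (a : ℝ) : Continuous fun u => cov H u a := by
  unfold cov
  refine Continuous.div_const ?_ 2
  have h : Continuous fun x : ℝ => |x| ^ (2 * H) :=
    continuous_abs.rpow_const fun _ => Or.inr (by linarith)
  exact (h.add continuous_const).sub (h.comp (continuous_id.sub continuous_const))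

theorem hasDerivAt_abs_rpow (p : ℝ) {x : ℝ} (hx : x ≠ 0) :
    HasDerivAt (fun x : ℝ => |x| ^ p) (SignType.sign x * (p * |x| ^ (p - 1))) x := by
  have h := (hasDerivAt_abs hx).rpow_const (p := p) (Or.inl (abs_ne_zero.2 hx))
  exact h.congr_deriv (by ring)

theorem hasDerivAt_cov (H : ℝ) {u a : ℝ} (hu : u ≠ 0) (hua : u ≠ a) :
    HasDerivAt (fun u => cov H u a)
      ((SignType.sign u * (2 * H * |u| ^ (2 * H - 1)) -
        SignType.sign (u - a) * (2 * H * |u - a| ^ (2 * H - 1))) / 2) u := by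
  have h1 := hasDerivAt_abs_rpow (2 * H) hu
  have h2 := (hasDerivAt_abs_rpow (2 * H) (sub_ne_zero.2 hua)).comp u
    ((hasDerivAt_id u).sub_const a)
  refine (((h1.add_const (|a| ^ (2 * H))).sub h2).div_const 2).congr_deriv ?_
  ring

theorem integrableOn_abs_sub_rpow {p : ℝ} (hp : -1 < p) (a T : ℝ) :
    IntegrableOn (fun u : ℝ => |u - a| ^ p) (Icc 0 T) := by
  -- On $[0,T]$ one has $|u-a|\le T+|a|$, so this cutoff makes the power integrable on the half-line
  -- without changing it where it is used.
  have h1 : IntegrableOn ((Ioo 0 (T + |a| + 1)).indicator fun x : ℝ => x ^ p) (Ioi 0) := by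
    rcases le_or_gt (T + |a| + 1) 0 with h | h
    · rw [Ioo_eq_empty (not_lt.2 h), indicator_empty]; exact integrableOn_zero
    · exact (((intervalIntegral.integrableOn_Ioo_rpow_iff h).2 hp).integrable_indicator
        measurableSet_Ioo).integrableOn
  have h2 := (integrable_comp_abs_of_integrableOn h1).comp_sub_right a
  refine h2.integrableOn.congr_fun_ae ((ae_restrict_iff' measurableSet_Icc).2 ?_)
  filter_upwards [Measure.ae_ne volume a] with u hu hut
  rw [indicator_of_mem]
  refine ⟨abs_pos.2 (sub_ne_zero.2 hu), ?_⟩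
  have := abs_sub u a
  rw [abs_of_nonneg hut.1] at this
  linarith [hut.2]

theorem integrableOn_deriv_cov {H : ℝ} (h0 : 0 < H) (a T : ℝ) :
    IntegrableOn (deriv fun u => cov H u a) (Icc 0 T) := by
  have h1 := integrableOn_abs_sub_rpow (p := 2 * H - 1) (by linarith) 0 T
  have h2 := integrableOn_abs_sub_rpow (p := 2 * H - 1) (by linarith) a T
  refine Integrable.mono' ((h1.add h2).const_mul H) (measurable_deriv _).aestronglyMeasurable
    (ae_restrict_of_ae ?_)
  filter_upwards [Measure.ae_ne volume a, Measure.ae_ne volume 0] with u hua hu0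
  have hs : ∀ x : ℝ, |((SignType.sign x : SignType) : ℝ)| ≤ 1 := by
    intro x
    rcases lt_trichotomy x 0 with h | h | h <;> simp [h]
  rw [(hasDerivAt_cov H hu0 hua).deriv, Pi.add_apply, sub_zero, Real.norm_eq_abs, abs_div, abs_two,
    div_le_iff₀ two_pos]
  refine (abs_sub _ _).trans ?_
  rw [abs_mul, abs_mul (SignType.sign (u - a) : ℝ)]
  have e : ∀ x : ℝ, |2 * H * |x| ^ (2 * H - 1)| = 2 * H * |x| ^ (2 * H - 1) := fun x =>
    abs_of_nonneg (by positivity)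
  rw [e, e]
  have p1 : 0 ≤ 2 * H * |u| ^ (2 * H - 1) := by positivity
  have p2 : 0 ≤ 2 * H * |u - a| ^ (2 * H - 1) := by positivity
  nlinarith [mul_le_mul_of_nonneg_right (hs u) p1, mul_le_mul_of_nonneg_right (hs (u - a)) p2]

/-- Integration by parts: the filtered covariance in terms of the derivative. -/
theorem ouFilter_cov_eq_integral {H : ℝ} (h0 : 0 < H) (a : ℝ) {t : ℝ} (ht : 0 ≤ t) :
    ouFilter (fun u => cov H u a) t =
      ∫ u in (0 : ℝ)..t, Real.exp (-(t - u)) * deriv (fun u => cov H u a) u := by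
  have hc := continuous_cov h0 a
  have hi : IntervalIntegrable (deriv fun u => cov H u a) volume 0 t :=
    (intervalIntegrable_iff_integrableOn_Ioc_of_le ht).2
      ((integrableOn_deriv_cov h0 a t).mono_set Ioc_subset_Icc_self)
  have hi1 : IntervalIntegrable (fun u => Real.exp (-(t - u)) * deriv (fun u => cov H u a) u)
      volume 0 t := hi.continuousOn_mul (by fun_prop)
  have hi2 : IntervalIntegrable (fun u => Real.exp (-(t - u)) * cov H u a) volume 0 t :=
    (Continuous.mul (by fun_prop) hc).intervalIntegrable _ _
  -- For $H<\frac12$ the derivative blows up at $0$ and at $a$. Continuity of the primitive and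
  -- integrability of the derivative are enough once these two points are excluded.
  have h := integral_eq_of_hasDerivAt_off_countable
    (fun u => Real.exp (-(t - u)) * cov H u a)
    (fun u => Real.exp (-(t - u)) * cov H u a +
      Real.exp (-(t - u)) * deriv (fun u => cov H u a) u) (a := 0) (b := t) (s := {0, a})
    (by simp) (Continuous.mul (by fun_prop) hc).continuousOn ?_ (hi2.add hi1)
  · rw [intervalIntegral.integral_add hi2 hi1] at h
    have hz : cov H 0 a = 0 := by
      simp [cov, Real.zero_rpow (by linarith : 2 * H ≠ 0)]
    simp only [sub_self, neg_zero, Real.exp_zero, one_mul, hz, mul_zero, sub_zero] at h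
    rw [ouFilter]
    linarith
  · intro u hu
    have hu' : u ≠ 0 ∧ u ≠ a := by simpa using hu.2
    have hd := hasDerivAt_cov H hu'.1 hu'.2
    exact (hasDerivAt_exp_shift t u).mul (hd.differentiableAt.hasDerivAt)

/-! ### The exponential kernel as a superposition of product kernels -/

/-- The kernel `e^{-(r-u)} 1_{u ≤ r}`. -/
def expKernel (r u : ℝ) : ℝ := if u ≤ r then Real.exp (-(r - u)) else 0

theorem measurable_expKernel : Measurable (Function.uncurry expKernel) :=
  Measurable.ite (measurableSet_le measurable_snd measurable_fst) (by fun_prop) measurable_const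

theorem abs_expKernel_le (r u : ℝ) : |expKernel r u| ≤ 1 := by
  unfold expKernel
  split_ifs with h
  · rw [Real.abs_exp]; exact Real.exp_le_one_iff.2 (by linarith)
  · simp

/-- The product of kernels lives on $r\ge m=\max(u,v)$, where it is $e^{u+v-2r}$. The integral gives
$e^{u+v-2m}-e^{u+v-2T}$; the extra term cancels the contribution of $T$, and $u+v-2m=-|u-v|$. -/
theorem integral_expKernel_mul {T u v : ℝ} (hu : u ∈ Icc 0 T) (hv : v ∈ Icc 0 T) :
    2 * (∫ r in (0 : ℝ)..T, expKernel r u * expKernel r v) + expKernel T u * expKernel T v =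
      Real.exp (-|u - v|) := by
  set m := max u v with hm
  have hmT : m ≤ T := max_le hu.2 hv.2
  have hm0 : 0 ≤ m := le_max_of_le_left hu.1
  have hz : ∀ r, r < m → expKernel r u * expKernel r v = 0 := by
    intro r hr
    rcases lt_max_iff.1 hr with h | h
    · rw [expKernel, if_neg (not_le.2 h), zero_mul]
    · rw [expKernel, expKernel, if_neg (not_le.2 h), mul_zero]
  have he : ∀ r, m ≤ r → expKernel r u * expKernel r v = Real.exp (u + v) * Real.exp (-2 * r) := by
    intro r hr
    rw [expKernel, expKernel, if_pos ((le_max_left _ _).trans hr),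
      if_pos ((le_max_right _ _).trans hr), ← Real.exp_add, ← Real.exp_add]
    ring_nf
  have hd : ∀ r, HasDerivAt (fun r => Real.exp (u + v) * (Real.exp (-2 * r) * (-1 / 2)))
      (Real.exp (u + v) * Real.exp (-2 * r)) r := by
    intro r
    have h1 : HasDerivAt (fun r : ℝ => -2 * r) (-2) r := by
      simpa using (hasDerivAt_id r).const_mul (-2 : ℝ)
    exact ((h1.exp.mul_const (-1 / 2)).const_mul _).congr_deriv (by ring)
  have i2 : ∫ r in m..T, expKernel r u * expKernel r v =
      Real.exp (u + v) * (Real.exp (-2 * T) * (-1 / 2)) -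
      Real.exp (u + v) * (Real.exp (-2 * m) * (-1 / 2)) := by
    rw [← intervalIntegral.integral_eq_sub_of_hasDerivAt (fun r _ => hd r)
      ((by fun_prop : Continuous _).intervalIntegrable _ _)]
    refine intervalIntegral.integral_congr fun r hr => ?_
    rw [uIcc_of_le hmT] at hr
    exact he r hr.1
  have i1 : ∫ r in (0 : ℝ)..m, expKernel r u * expKernel r v = 0 := by
    refine intervalIntegral.integral_zero_ae ?_
    filter_upwards [Measure.ae_ne volume m] with r hr hr2
    rw [uIoc_of_le hm0] at hr2
    exact hz r (lt_of_le_of_ne hr2.2 hr)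
  have hint : ∀ a b : ℝ, IntervalIntegrable (fun r => expKernel r u * expKernel r v) volume a b := by
    intro a b
    refine (intervalIntegrable_const (c := (1 : ℝ))).mono_fun ?_ ?_
    · exact ((measurable_expKernel.comp measurable_prodMk_right).mul
        (measurable_expKernel.comp measurable_prodMk_right)).aestronglyMeasurable
    · refine Filter.Eventually.of_forall fun r => ?_
      simp only [norm_mul, Real.norm_eq_abs, abs_one]
      exact mul_le_one₀ (abs_expKernel_le r u) (abs_nonneg _) (abs_expKernel_le r v)
  have hmax : u + v - 2 * m = -|u - v| := by
    rcases le_total u v with h | h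
    · rw [hm, max_eq_right h, abs_of_nonpos (by linarith)]; ring
    · rw [hm, max_eq_left h, abs_of_nonneg (by linarith)]; ring
  rw [← intervalIntegral.integral_add_adjacent_intervals (hint 0 m) (hint m T), i1, i2, he T hmT,
    ← hmax, show u + v - 2 * m = (u + v) + (-2 * m) by ring, Real.exp_add (u + v)]
  ring

theorem setIntegral_expKernel_mul {r T : ℝ} (hr : r ∈ Icc 0 T) (f : ℝ → ℝ) :
    ∫ u in Icc 0 T, expKernel r u * f u = ∫ u in (0 : ℝ)..r, Real.exp (-(r - u)) * f u := by
  rw [intervalIntegral.integral_of_le hr.1, ← integral_Icc_eq_integral_Ioc]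
  have h : ∀ u, expKernel r u * f u =
      (Iic r).indicator (fun u => Real.exp (-(r - u)) * f u) u := by
    intro u
    simp only [expKernel, indicator, mem_Iic]
    split_ifs <;> simp
  simp only [h]
  rw [setIntegral_indicator measurableSet_Iic]
  congr 2
  ext u
  simp only [mem_inter_iff, mem_Icc, mem_Iic]
  constructor
  · exact fun h => ⟨h.1.1, h.2⟩
  · exact fun h => ⟨⟨h.1, h.2.trans hr.2⟩, h.2⟩

theorem setIntegral_expKernel_prod {r T : ℝ} (hr : r ∈ Icc 0 T) (f g : ℝ → ℝ) :
    ∫ p in Icc (0 : ℝ) T ×ˢ Icc (0 : ℝ) T, expKernel r p.1 * expKernel r p.2 * f p.1 * g p.2 =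
      (∫ u in (0 : ℝ)..r, Real.exp (-(r - u)) * f u) *
        ∫ u in (0 : ℝ)..r, Real.exp (-(r - u)) * g u := by
  rw [← setIntegral_expKernel_mul hr, ← setIntegral_expKernel_mul hr, ← setIntegral_prod_mul]
  rw [Measure.volume_eq_prod]
  congr 1
  ext p
  ring

/-- Inserting the superposition and exchanging the integrals makes the variables separate for each
$r$, so only products of one-dimensional filtered integrals remain. -/
theorem setIntegral_exp_abs_sub {T : ℝ} (hT : 0 ≤ T) {f g : ℝ → ℝ} (hf : IntegrableOn f (Icc 0 T))
    (hg : IntegrableOn g (Icc 0 T)) :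
    ∫ p in Icc (0 : ℝ) T ×ˢ Icc (0 : ℝ) T, Real.exp (-|p.1 - p.2|) * f p.1 * g p.2 =
      2 * (∫ r in (0 : ℝ)..T, (∫ u in (0 : ℝ)..r, Real.exp (-(r - u)) * f u) *
        ∫ u in (0 : ℝ)..r, Real.exp (-(r - u)) * g u) +
      (∫ u in (0 : ℝ)..T, Real.exp (-(T - u)) * f u) *
        ∫ u in (0 : ℝ)..T, Real.exp (-(T - u)) * g u := by
  have hfg : Integrable (fun p : ℝ × ℝ => f p.1 * g p.2)
      (volume.restrict (Icc (0 : ℝ) T ×ˢ Icc (0 : ℝ) T)) := by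
    rw [Measure.volume_eq_prod, ← Measure.prod_restrict]
    exact Integrable.mul_prod hf hg
  have hk : Measurable fun q : ℝ × ℝ × ℝ => expKernel q.1 q.2.1 * expKernel q.1 q.2.2 :=
    (measurable_expKernel.comp (by fun_prop : Measurable fun q : ℝ × ℝ × ℝ => (q.1, q.2.1))).mul
      (measurable_expKernel.comp (by fun_prop : Measurable fun q : ℝ × ℝ × ℝ => (q.1, q.2.2)))
  have hk1 : ∀ r u v, ‖expKernel r u * expKernel r v‖ ≤ 1 := by
    intro r u v
    rw [norm_mul]
    exact mul_le_one₀ (abs_expKernel_le r u) (abs_nonneg _) (abs_expKernel_le r v)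
  have hprod : Integrable (Function.uncurry fun (r : ℝ) (p : ℝ × ℝ) =>
      expKernel r p.1 * expKernel r p.2 * (f p.1 * g p.2))
      ((volume.restrict (uIoc 0 T)).prod (volume.restrict (Icc (0 : ℝ) T ×ˢ Icc (0 : ℝ) T))) := by
    have h1 : Integrable (fun q : ℝ × ℝ × ℝ => (1 : ℝ) * (f q.2.1 * g q.2.2))
        ((volume.restrict (uIoc 0 T)).prod (volume.restrict (Icc (0 : ℝ) T ×ˢ Icc (0 : ℝ) T))) :=
      Integrable.mul_prod (f := fun _ : ℝ => (1 : ℝ))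
        (integrableOn_const (by rw [uIoc_of_le hT]; simp)) hfg
    simp only [one_mul] at h1
    exact h1.bdd_mul (c := 1) hk.aestronglyMeasurable
      (Filter.Eventually.of_forall fun q => hk1 q.1 q.2.1 q.2.2)
  have hswap := intervalIntegral_integral_swap hprod
  have hlast : Integrable (fun p : ℝ × ℝ => expKernel T p.1 * expKernel T p.2 * (f p.1 * g p.2))
      (volume.restrict (Icc (0 : ℝ) T ×ˢ Icc (0 : ℝ) T)) :=
    hfg.bdd_mul (c := 1)
      (hk.comp (measurable_prodMk_left (x := T))).aestronglyMeasurable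
      (Filter.Eventually.of_forall fun p => hk1 T p.1 p.2)
  have hI : Integrable (fun p : ℝ × ℝ => ∫ r in (0 : ℝ)..T,
      expKernel r p.1 * expKernel r p.2 * (f p.1 * g p.2))
      (volume.restrict (Icc (0 : ℝ) T ×ˢ Icc (0 : ℝ) T)) := by
    have h := hprod.integral_prod_right
    simp only [uIoc_of_le hT] at h
    simp only [intervalIntegral.integral_of_le hT]
    exact h
  have e1 : ∀ r ∈ Icc 0 T, ∫ p in Icc (0 : ℝ) T ×ˢ Icc (0 : ℝ) T,
      expKernel r p.1 * expKernel r p.2 * (f p.1 * g p.2) =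
      (∫ u in (0 : ℝ)..r, Real.exp (-(r - u)) * f u) *
        ∫ u in (0 : ℝ)..r, Real.exp (-(r - u)) * g u := by
    intro r hr
    rw [← setIntegral_expKernel_prod hr]
    simp only [mul_assoc]
  have e2 : ∫ r in (0 : ℝ)..T, (∫ u in (0 : ℝ)..r, Real.exp (-(r - u)) * f u) *
        (∫ u in (0 : ℝ)..r, Real.exp (-(r - u)) * g u) =
      ∫ p in Icc (0 : ℝ) T ×ˢ Icc (0 : ℝ) T, ∫ r in (0 : ℝ)..T,
        expKernel r p.1 * expKernel r p.2 * (f p.1 * g p.2) := by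
    rw [← hswap]
    refine intervalIntegral.integral_congr fun r hr => ?_
    rw [uIcc_of_le hT] at hr
    exact (e1 r hr).symm
  rw [e2, ← e1 T ⟨hT, le_rfl⟩, ← integral_const_mul, ← integral_add (hI.const_mul 2) hlast]
  refine setIntegral_congr_fun (measurableSet_Icc.prod measurableSet_Icc) fun p hp => ?_
  rw [← integral_expKernel_mul hp.1 hp.2, intervalIntegral.integral_mul_const]
  ring

/-! ### The Ornstein-Uhlenbeck curve in the canonical Hilbert space -/

section HilbertSpace

variable (H : Ioo (0 : ℝ) 1) (T : ℝ)

theorem norm_ind_sub_sq (s t : Icc (0 : ℝ) T) :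
    ‖ind H T s - ind H T t‖ ^ 2 = |(s : ℝ) - t| ^ (2 * (H : ℝ)) := by
  have h0 := H.2.1
  rw [norm_sub_sq_real, ← real_inner_self_eq_norm_sq, ← real_inner_self_eq_norm_sq, inner_ind,
    inner_ind, inner_ind]
  simp only [cov, sub_self, abs_zero, Real.zero_rpow (by linarith : 2 * (H : ℝ) ≠ 0)]
  ring

theorem continuous_ind : Continuous (ind H T) := by
  have h0 := H.2.1
  refine continuous_iff_continuousAt.2 fun s => tendsto_iff_norm_sub_tendsto_zero.2 ?_
  have hc : Continuous fun t : Icc (0 : ℝ) T => Real.sqrt (|(t : ℝ) - s| ^ (2 * (H : ℝ))) := by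
    refine Real.continuous_sqrt.comp (Continuous.rpow_const (by fun_prop) fun _ => Or.inr ?_)
    linarith
  have h := hc.tendsto s
  simp only [sub_self, abs_zero, Real.zero_rpow (by linarith : 2 * (H : ℝ) ≠ 0),
    Real.sqrt_zero] at h
  refine h.congr fun t => ?_
  rw [← norm_ind_sub_sq, Real.sqrt_sq (norm_nonneg _)]

variable {T} (hT : 0 ≤ T)

/-- The curve `t ↦ 1_[0,t]`, extended to the real line by constants. -/
def indCurve (t : ℝ) : CanonicalSpace H T := ind H T (projIcc 0 T hT t)

theorem continuous_indCurve : Continuous (indCurve H hT) :=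
  (continuous_ind H T).comp continuous_projIcc

theorem inner_indCurve_ind {t : ℝ} (ht : t ∈ Icc 0 T) (a : Icc (0 : ℝ) T) :
    inner ℝ (indCurve H hT t) (ind H T a) = cov H t a := by
  rw [indCurve, inner_ind, projIcc_of_mem hT ht]

theorem inner_indCurve {t s : ℝ} (ht : t ∈ Icc 0 T) (hs : s ∈ Icc 0 T) :
    inner ℝ (indCurve H hT t) (indCurve H hT s) = cov H t s := by
  rw [indCurve, indCurve, inner_ind, projIcc_of_mem hT ht, projIcc_of_mem hT hs]

/-- The function `e^{-(t - ·)} 1_[0,t]` as an element of the canonical space. -/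
def ouCurve (t : ℝ) : CanonicalSpace H T :=
  indCurve H hT t - ∫ u in (0 : ℝ)..t, Real.exp (-(t - u)) • indCurve H hT u

theorem continuous_ouCurve : Continuous (ouCurve H hT) := by
  -- Pulling out $e^{-t}$ leaves an integrand independent of $t$, so the integral is a continuous
  -- primitive.
  have h : ouCurve H hT = fun t => indCurve H hT t -
      Real.exp (-t) • ∫ u in (0 : ℝ)..t, Real.exp u • indCurve H hT u := by
    ext1 t
    rw [ouCurve, ← intervalIntegral.integral_smul]
    congr 2
    ext1 u
    rw [smul_smul, ← Real.exp_add]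
    congr 2
    ring
  rw [h]
  have hc := continuous_indCurve H hT
  exact hc.sub ((by fun_prop : Continuous fun t : ℝ => Real.exp (-t)).smul
    (intervalIntegral.continuous_primitive
      (fun a b => (Real.continuous_exp.smul hc).intervalIntegrable a b) 0))

theorem inner_intervalIntegral {E : Type*} [NormedAddCommGroup E] [InnerProductSpace ℝ E]
    [CompleteSpace E] {f : ℝ → E} (hf : Continuous f) (a b : ℝ) (x : E) :
    inner ℝ (∫ u in a..b, f u) x = ∫ u in a..b, inner ℝ (f u) x := by
  have h := (innerSL ℝ x).intervalIntegral_comp_comm (hf.intervalIntegrable (μ := volume) a b)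
  simp only [innerSL_apply_apply] at h
  rw [real_inner_comm, ← h]
  simp only [real_inner_comm x]

theorem inner_ouCurve (t : ℝ) (x : CanonicalSpace H T) :
    inner ℝ (ouCurve H hT t) x = ouFilter (fun u => inner ℝ (indCurve H hT u) x) t := by
  have hc : Continuous fun u : ℝ => Real.exp (-(t - u)) • indCurve H hT u :=
    (by fun_prop : Continuous fun u : ℝ => Real.exp (-(t - u))).smul (continuous_indCurve H hT)
  rw [ouCurve, inner_sub_left, inner_intervalIntegral hc, ouFilter]
  simp only [real_inner_smul_left]

theorem inner_ouCurve_ind {t : ℝ} (ht : t ∈ Icc 0 T) (a : Icc (0 : ℝ) T) :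
    inner ℝ (ouCurve H hT t) (ind H T a) = ouFilter (fun u => cov H u a) t := by
  rw [inner_ouCurve]
  exact ouFilter_congr ht.1 fun u hu => inner_indCurve_ind H hT ⟨hu.1, hu.2.trans ht.2⟩ a

/-- Inner products pass through the Bochner integral, so each argument contributes one `ouFilter`
applied to the covariance. -/
theorem inner_ouCurve_ouCurve {t s : ℝ} (ht : t ∈ Icc 0 T) (hs : s ∈ Icc 0 T) :
    inner ℝ (ouCurve H hT t) (ouCurve H hT s) = startedCov (ouCov H) t s := by
  rw [real_inner_comm, inner_ouCurve, ← ouFilter_ouFilter_cov H.2.1 H.2.2 ht.1 hs.1]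
  refine ouFilter_congr hs.1 fun a ha => ?_
  have ha' : a ∈ Icc 0 T := ⟨ha.1, ha.2.trans hs.2⟩
  rw [real_inner_comm, inner_ouCurve]
  exact ouFilter_congr ht.1 fun u hu => inner_indCurve H hT ⟨hu.1, hu.2.trans ht.2⟩ ha'

theorem norm_indCurve {t : ℝ} (ht : t ∈ Icc 0 T) : ‖indCurve H hT t‖ = t ^ (H : ℝ) := by
  have h0 := H.2.1
  have h : ‖indCurve H hT t‖ ^ 2 = (t ^ (H : ℝ)) ^ 2 := by
    rw [← real_inner_self_eq_norm_sq, inner_indCurve H hT ht ht, cov, sub_self, abs_zero,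
      Real.zero_rpow (by linarith : 2 * (H : ℝ) ≠ 0), abs_of_nonneg ht.1,
      ← Real.rpow_mul_natCast ht.1]
    push_cast
    rw [mul_comm 2 (H : ℝ)]
    ring
  exact (pow_left_inj₀ (norm_nonneg _) (Real.rpow_nonneg ht.1 _) two_ne_zero).1 h

theorem norm_ouCurve_le (hT1 : T ≤ 1) {t : ℝ} (ht : t ∈ Icc 0 T) :
    ‖ouCurve H hT t‖ ≤ 2 * T ^ (H : ℝ) := by
  have hmono : ∀ u ∈ Icc 0 T, ‖indCurve H hT u‖ ≤ T ^ (H : ℝ) := fun u hu => by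
    rw [norm_indCurve H hT hu]; exact Real.rpow_le_rpow hu.1 hu.2 H.2.1.le
  have hTp : 0 ≤ T ^ (H : ℝ) := Real.rpow_nonneg hT _
  have hI : ‖∫ u in (0 : ℝ)..t, Real.exp (-(t - u)) • indCurve H hT u‖ ≤
      T ^ (H : ℝ) * |t - 0| := by
    refine intervalIntegral.norm_integral_le_of_norm_le_const fun u hu => ?_
    rw [uIoc_of_le ht.1] at hu
    rw [norm_smul, Real.norm_eq_abs, Real.abs_exp]
    calc _ ≤ 1 * T ^ (H : ℝ) := mul_le_mul (Real.exp_le_one_iff.2 (by linarith [hu.2]))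
          (hmono u ⟨hu.1.le, hu.2.trans ht.2⟩) (norm_nonneg _) zero_le_one
      _ = _ := one_mul _
  rw [sub_zero, abs_of_nonneg ht.1] at hI
  calc _ ≤ ‖indCurve H hT t‖ + ‖∫ u in (0 : ℝ)..t, Real.exp (-(t - u)) • indCurve H hT u‖ :=
        norm_sub_le _ _
    _ ≤ T ^ (H : ℝ) + T ^ (H : ℝ) * 1 := add_le_add (hmono t ht)
        (hI.trans (mul_le_mul_of_nonneg_left (ht.2.trans hT1) hTp))
    _ = _ := by ring

/-! ### The tensor square -/

/-- The square `x ⊗ x` in the Hilbert space tensor product. -/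
def tensorSq (x : CanonicalSpace H T) : TensorSquare H T :=
  ((x ⊗ₜ[ℝ] x : CanonicalSpace H T ⊗[ℝ] CanonicalSpace H T))

theorem continuous_tensorSq : Continuous (tensorSq H (T := T)) :=
  (UniformSpace.Completion.continuous_coe _).comp
    (TensorProduct.continuous_tmul.comp (continuous_id.prodMk continuous_id))

theorem inner_tensorSq_ind₂ (x : CanonicalSpace H T) (a b : Icc (0 : ℝ) T) :
    inner ℝ (tensorSq H x) (ind₂ H T a b) =
      inner ℝ x (ind H T a) * inner ℝ x (ind H T b) := by
  rw [tensorSq, ind₂, UniformSpace.Completion.inner_coe, TensorProduct.inner_tmul]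

theorem inner_tensorSq (x y : CanonicalSpace H T) :
    inner ℝ (tensorSq H x) (tensorSq H y) = inner ℝ x y ^ 2 := by
  rw [tensorSq, tensorSq, UniformSpace.Completion.inner_coe, TensorProduct.inner_tmul, sq]

theorem eq_zero_of_inner_ind_eq_zero (ℓ : CanonicalSpace H T →L[ℝ] ℝ)
    (h : ∀ a, ℓ (ind H T a) = 0) : ℓ = 0 := by
  have hlin : (ℓ.toLinearMap ∘ₗ
      (UniformSpace.Completion.toComplL : Step H T →L[ℝ] CanonicalSpace H T).toLinearMap :
      (Icc (0 : ℝ) T →₀ ℝ) →ₗ[ℝ] ℝ) = 0 := by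
    refine Finsupp.lhom_ext' fun a => LinearMap.ext_ring ?_
    exact h a
  ext x
  refine UniformSpace.Completion.induction_on x (isClosed_eq ℓ.continuous continuous_const)
    fun y => ?_
  exact DFunLike.congr_fun hlin y

/-- Pairing with $d$ is a bounded bilinear form on $\mathfrak H\times\mathfrak H$. Density of the
step functions kills one argument at a time, then linearity and density of the algebraic tensors
give $d\perp d$. -/
theorem eq_zero_of_inner_ind₂_eq_zero {d : TensorSquare H T}
    (h : ∀ a b, inner ℝ d (ind₂ H T a b) = 0) : d = 0 := by
  let L : CanonicalSpace H T →L[ℝ] CanonicalSpace H T →L[ℝ] ℝ :=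
    (ContinuousLinearMap.compL ℝ _ _ ℝ ((innerSL ℝ d).comp
      (UniformSpace.Completion.toComplL (𝕜 := ℝ)))).comp
      (TensorProduct.mkL ℝ (CanonicalSpace H T) (CanonicalSpace H T))
  have hL : ∀ x y, L x y = inner ℝ d
      (((x ⊗ₜ[ℝ] y : CanonicalSpace H T ⊗[ℝ] CanonicalSpace H T)) : TensorSquare H T) :=
    fun x y => rfl
  have h1 : ∀ a, L (ind H T a) = 0 := fun a =>
    eq_zero_of_inner_ind_eq_zero H _ fun b => h a b
  have h2 : ∀ y, L.flip y = 0 := fun y =>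
    eq_zero_of_inner_ind_eq_zero H _ fun a => by
      rw [ContinuousLinearMap.flip_apply, h1]; rfl
  have h3 : ∀ z : CanonicalSpace H T ⊗[ℝ] CanonicalSpace H T,
      inner ℝ d (z : TensorSquare H T) = 0 := by
    intro z
    induction z using TensorProduct.induction_on with
    | zero => rw [UniformSpace.Completion.coe_zero, inner_zero_right]
    | tmul x y => rw [← hL, ← ContinuousLinearMap.flip_apply, h2]; rfl
    | add z w hz hw => rw [UniformSpace.Completion.coe_add, inner_add_right, hz, hw, add_zero]
  refine inner_self_eq_zero (𝕜 := ℝ).1 ?_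
  exact UniformSpace.Completion.induction_on (p := fun z => inner ℝ d z = 0) d
    (isClosed_eq (by fun_prop) continuous_const) h3

/-- The element of the tensor square given by `f_T`. -/
def fTElement : TensorSquare H T :=
  (2 : ℝ) • (∫ r in (0 : ℝ)..T, tensorSq H (ouCurve H hT r)) + tensorSq H (ouCurve H hT T)

theorem inner_fTElement (x : TensorSquare H T) :
    inner ℝ (fTElement H hT) x =
      2 * (∫ r in (0 : ℝ)..T, inner ℝ (tensorSq H (ouCurve H hT r)) x) +
        inner ℝ (tensorSq H (ouCurve H hT T)) x := by
  have hc : Continuous fun r => tensorSq H (ouCurve H hT r) :=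
    (continuous_tensorSq H).comp (continuous_ouCurve H hT)
  rw [fTElement, inner_add_left, real_inner_smul_left, inner_intervalIntegral hc]

/-- Against $\mathbf 1_{[0,a]}\otimes\mathbf 1_{[0,b]}$ each square $x_r\otimes x_r$ gives a product
of two filtered covariances, which integration by parts matches with the factors produced by
`setIntegral_exp_abs_sub`. -/
theorem isElement_fTElement : IsElement H T (fT T) (fTElement H hT) := by
  intro a b
  have h0 := H.2.1
  have hf := integrableOn_deriv_cov h0 a T
  have hg := integrableOn_deriv_cov h0 b T
  have hfT : ∀ p ∈ Icc (0 : ℝ) T ×ˢ Icc (0 : ℝ) T, Real.exp (-|p.1 - p.2|) *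
      deriv (fun u => cov H u a) p.1 * deriv (fun v => cov H v b) p.2 =
      fT T p.1 p.2 * deriv (fun u => cov H u a) p.1 * deriv (fun v => cov H v b) p.2 := by
    intro p hp
    rw [fT, indicator_of_mem hp]
  have hms := (measurableSet_Icc (a := (0 : ℝ)) (b := T)).prod (measurableSet_Icc (a := (0 : ℝ)) (b := T))
  constructor
  · refine (integrableOn_congr_fun hfT hms).1 ?_
    have hfg : IntegrableOn (fun p : ℝ × ℝ => deriv (fun u => cov H u a) p.1 *
        deriv (fun v => cov H v b) p.2) (Icc (0 : ℝ) T ×ˢ Icc (0 : ℝ) T) := by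
      rw [IntegrableOn, Measure.volume_eq_prod, ← Measure.prod_restrict]
      exact Integrable.mul_prod hf hg
    simp only [mul_assoc]
    refine hfg.bdd_mul (c := 1) (by fun_prop : Measurable _).aestronglyMeasurable
      (Filter.Eventually.of_forall fun p => ?_)
    rw [Real.norm_eq_abs, Real.abs_exp]
    exact Real.exp_le_one_iff.2 (by simp)
  · rw [← setIntegral_congr_fun hms hfT, setIntegral_exp_abs_sub hT hf hg, inner_fTElement]
    have e : ∀ r ∈ Icc 0 T, inner ℝ (tensorSq H (ouCurve H hT r)) (ind₂ H T a b) =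
        (∫ u in (0 : ℝ)..r, Real.exp (-(r - u)) * deriv (fun u => cov H u a) u) *
        ∫ u in (0 : ℝ)..r, Real.exp (-(r - u)) * deriv (fun u => cov H u b) u := by
      intro r hr
      rw [inner_tensorSq_ind₂, inner_ouCurve_ind H hT hr, inner_ouCurve_ind H hT hr,
        ouFilter_cov_eq_integral h0 _ hr.1, ouFilter_cov_eq_integral h0 _ hr.1]
    rw [e T ⟨hT, le_rfl⟩]
    congr 2
    refine intervalIntegral.integral_congr fun r hr => ?_
    rw [uIcc_of_le hT] at hr
    exact e r hr

theorem IsElement.unique {f : ℝ → ℝ → ℝ} {h k : TensorSquare H T} (hh : IsElement H T f h)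
    (hk : IsElement H T f k) : h = k := by
  refine sub_eq_zero.1 (eq_zero_of_inner_ind₂_eq_zero H fun a b => ?_)
  rw [inner_sub_left, (hh a b).2, (hk a b).2, sub_self]

theorem norm_sq_fTElement : ‖fTElement H hT‖ ^ 2 =
    2 * (∫ r in (0 : ℝ)..T, (2 * (∫ q in (0 : ℝ)..T, startedCov (ouCov H) r q ^ 2) + startedCov (ouCov H) r T ^ 2)) +
      (2 * (∫ q in (0 : ℝ)..T, startedCov (ouCov H) T q ^ 2) + startedCov (ouCov H) T T ^ 2) := by
  have e : ∀ r ∈ Icc 0 T, inner ℝ (tensorSq H (ouCurve H hT r)) (fTElement H hT) =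
      2 * (∫ q in (0 : ℝ)..T, startedCov (ouCov H) r q ^ 2) + startedCov (ouCov H) r T ^ 2 := by
    intro r hr
    have e1 : ∀ q ∈ Icc 0 T, inner ℝ (tensorSq H (ouCurve H hT q)) (tensorSq H (ouCurve H hT r)) =
        startedCov (ouCov H) r q ^ 2 := fun q hq => by
      rw [inner_tensorSq, real_inner_comm, inner_ouCurve_ouCurve H hT hr hq]
    rw [real_inner_comm, inner_fTElement, e1 T ⟨hT, le_rfl⟩]
    congr 2
    refine intervalIntegral.integral_congr fun q hq => ?_
    rw [uIcc_of_le hT] at hq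
    exact e1 q hq
  rw [← real_inner_self_eq_norm_sq, inner_fTElement, e T ⟨hT, le_rfl⟩]
  congr 2
  refine intervalIntegral.integral_congr fun r hr => ?_
  rw [uIcc_of_le hT] at hr
  exact e r hr

/-- Bound of `f_T` for short time intervals. -/
theorem norm_sq_fTElement_le (hT1 : T ≤ 1) :
    ‖fTElement H hT‖ ^ 2 ≤ 144 * T ^ (4 * (H : ℝ)) := by
  have hb : ∀ r ∈ Icc 0 T, ‖tensorSq H (ouCurve H hT r)‖ ≤ 4 * T ^ (2 * (H : ℝ)) := by
    intro r hr
    rw [tensorSq, UniformSpace.Completion.norm_coe, TensorProduct.norm_tmul]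
    have h := norm_ouCurve_le H hT hT1 hr
    calc _ ≤ (2 * T ^ (H : ℝ)) * (2 * T ^ (H : ℝ)) :=
          mul_le_mul h h (norm_nonneg _) ((norm_nonneg _).trans h)
      _ = 4 * (T ^ (H : ℝ)) ^ 2 := by ring
      _ = _ := by rw [← Real.rpow_mul_natCast hT]; push_cast; rw [mul_comm (H : ℝ)]
  have hI : ‖∫ r in (0 : ℝ)..T, tensorSq H (ouCurve H hT r)‖ ≤
      4 * T ^ (2 * (H : ℝ)) * |T - 0| := by
    refine intervalIntegral.norm_integral_le_of_norm_le_const fun u hu => ?_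
    rw [uIoc_of_le hT] at hu
    exact hb u ⟨hu.1.le, hu.2⟩
  rw [sub_zero, abs_of_nonneg hT] at hI
  have hp : 0 ≤ T ^ (2 * (H : ℝ)) := Real.rpow_nonneg hT _
  -- The constant is $12=2\cdot4+4$, using $T\le1$ for the integral term.
  have hn : ‖fTElement H hT‖ ≤ 12 * T ^ (2 * (H : ℝ)) := by
    refine (norm_add_le _ _).trans ?_
    rw [norm_smul, Real.norm_two]
    have h1 := hb T ⟨hT, le_rfl⟩
    nlinarith [mul_le_mul_of_nonneg_left hT1 hp]
  calc _ ≤ (12 * T ^ (2 * (H : ℝ))) ^ 2 := pow_le_pow_left₀ (norm_nonneg _) hn 2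
    _ = 144 * (T ^ (2 * (H : ℝ))) ^ 2 := by ring
    _ = _ := by rw [← Real.rpow_mul_natCast hT]; push_cast; ring_nf

end HilbertSpace

/-! ### Asymptotics of the energy of a started stationary process -/

section Asymptotics

variable {ρ : ℝ → ℝ} {T : ℝ}

/-- The squared Hilbert-Schmidt type energy that gives the norm of `f_T`. -/
def startedEnergy (ρ : ℝ → ℝ) (T : ℝ) : ℝ :=
  2 * (∫ r in (0 : ℝ)..T, (2 * (∫ q in (0 : ℝ)..T, startedCov ρ r q ^ 2) +
    startedCov ρ r T ^ 2)) +
  (2 * (∫ q in (0 : ℝ)..T, startedCov ρ T q ^ 2) + startedCov ρ T T ^ 2)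

/-- The primitive of `ρ²`. -/
def sqPrimitive (ρ : ℝ → ℝ) (r : ℝ) : ℝ := ∫ x in (0 : ℝ)..r, ρ x ^ 2

theorem sqPrimitive_nonneg {r : ℝ} (hr : 0 ≤ r) : 0 ≤ sqPrimitive ρ r :=
  intervalIntegral.integral_nonneg hr fun _ _ => sq_nonneg _

theorem continuous_sqPrimitive (hc : Continuous ρ) : Continuous (sqPrimitive ρ) :=
  intervalIntegral.continuous_primitive (fun a b => (hc.pow 2).intervalIntegrable a b) 0

theorem sqPrimitive_mono (hc : Continuous ρ) {r s : ℝ} (h : r ≤ s) :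
    sqPrimitive ρ r ≤ sqPrimitive ρ s := by
  have hi : ∀ a b, IntervalIntegrable (fun x => ρ x ^ 2) volume a b := fun a b =>
    (hc.pow 2).intervalIntegrable a b
  have h1 := intervalIntegral.integral_add_adjacent_intervals (hi 0 r) (hi r s)
  have h2 : 0 ≤ ∫ x in r..s, ρ x ^ 2 := intervalIntegral.integral_nonneg h fun _ _ => sq_nonneg _
  simp only [sqPrimitive]
  linarith

/-- Cutting at $q=r$ and using evenness reduces the stationary double integral to the one-variable
function `sqPrimitive`. -/
theorem integral_sub_sq (hc : Continuous ρ) (he : ∀ x, ρ (-x) = ρ x) (r T : ℝ) :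
    ∫ q in (0 : ℝ)..T, ρ (r - q) ^ 2 = sqPrimitive ρ r + sqPrimitive ρ (T - r) := by
  have hi : ∀ a b, IntervalIntegrable (fun x => ρ x ^ 2) volume a b := fun a b =>
    (hc.pow 2).intervalIntegrable a b
  rw [intervalIntegral.integral_comp_sub_left (fun x => ρ x ^ 2) r, sub_zero,
    ← intervalIntegral.integral_add_adjacent_intervals (hi (r - T) 0) (hi 0 r), add_comm]
  have h : ∫ x in (r - T)..0, ρ x ^ 2 = ∫ x in (0 : ℝ)..(T - r), ρ (-x) ^ 2 := by
    rw [intervalIntegral.integral_comp_neg (fun x => ρ x ^ 2)]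
    simp
  rw [h]
  simp only [he, sqPrimitive]

theorem integral_sub_sq_le (hc : Continuous ρ) (he : ∀ x, ρ (-x) = ρ x) {r : ℝ}
    (hr : r ∈ Icc 0 T) : ∫ q in (0 : ℝ)..T, ρ (r - q) ^ 2 ≤ 2 * sqPrimitive ρ T := by
  rw [integral_sub_sq hc he]
  have h1 := sqPrimitive_mono hc hr.2
  have h2 := sqPrimitive_mono hc (by linarith [hr.1] : T - r ≤ T)
  linarith

theorem integral_integral_sub_sq (hc : Continuous ρ) (he : ∀ x, ρ (-x) = ρ x) (T : ℝ) :
    ∫ r in (0 : ℝ)..T, ∫ q in (0 : ℝ)..T, ρ (r - q) ^ 2 =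
      2 * ∫ r in (0 : ℝ)..T, sqPrimitive ρ r := by
  have hp := continuous_sqPrimitive hc
  simp only [integral_sub_sq hc he]
  have hp' : Continuous fun r => sqPrimitive ρ (T - r) := hp.comp (by fun_prop)
  rw [intervalIntegral.integral_add (hp.intervalIntegrable _ _) (hp'.intervalIntegrable _ _),
    intervalIntegral.integral_comp_sub_left (sqPrimitive ρ) T]
  simp only [sub_self, sub_zero]
  ring

theorem integral_exp_neg_le (T : ℝ) : ∫ r in (0 : ℝ)..T, Real.exp (-r) ≤ 1 := by
  have h := intervalIntegral.integral_comp_neg (a := 0) (b := T) Real.exp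
  rw [h, neg_zero, integral_exp, Real.exp_zero]
  linarith [Real.exp_pos (-T)]

theorem abs_integral_sub_integral_le {f g h : ℝ → ℝ} (hf : Continuous f) (hg : Continuous g)
    (hh : Continuous h) (hT : 0 ≤ T) (hb : ∀ x ∈ Icc 0 T, |f x - g x| ≤ h x) :
    |(∫ x in (0 : ℝ)..T, f x) - ∫ x in (0 : ℝ)..T, g x| ≤ ∫ x in (0 : ℝ)..T, h x := by
  rw [← intervalIntegral.integral_sub (hf.intervalIntegrable _ _) (hg.intervalIntegrable _ _)]
  refine (intervalIntegral.abs_integral_le_integral_abs hT).trans ?_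
  exact intervalIntegral.integral_mono_on hT ((hf.sub hg).abs.intervalIntegrable _ _)
    (hh.intervalIntegrable _ _) hb

theorem continuous_startedCov (hc : Continuous ρ) :
    Continuous (Function.uncurry (startedCov ρ)) := by
  unfold Function.uncurry startedCov
  fun_prop

/-- Half of the error made when the started covariance is replaced by the stationary one. -/
def startedError (ρ : ℝ → ℝ) (r q : ℝ) : ℝ :=
  Real.exp (-r) * (2 * ρ (r - q) ^ 2 + 4 * ρ q ^ 2 + 4 * ρ 0 ^ 2 * Real.exp (-q))

theorem continuous_startedError (hc : Continuous ρ) :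
    Continuous (Function.uncurry (startedError ρ)) := by
  unfold Function.uncurry startedError
  fun_prop

/-- Every term of the expanded difference contains $e^{-r}$ or $e^{-q}$. Young's inequality removes
the cross products while keeping one such factor, and each term is charged to the variable whose
exponential it keeps. -/
theorem abs_startedCov_sq_sub_le (he : ∀ x, ρ (-x) = ρ x) {r q : ℝ} (hr : 0 ≤ r) (hq : 0 ≤ q) :
    |startedCov ρ r q ^ 2 - ρ (r - q) ^ 2| ≤ startedError ρ r q + startedError ρ q r := by
  have hx : ρ (q - r) = ρ (r - q) := by rw [← he, neg_sub]
  have ha0 := Real.exp_pos (-r)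
  have hb0 := Real.exp_pos (-q)
  have ha1 : Real.exp (-r) ≤ 1 := Real.exp_le_one_iff.2 (by linarith)
  have hb1 : Real.exp (-q) ≤ 1 := Real.exp_le_one_iff.2 (by linarith)
  simp only [startedError, startedCov, hx]
  generalize Real.exp (-r) = a at *
  generalize Real.exp (-q) = b at *
  generalize ρ (r - q) = x at *
  generalize ρ r = u at *
  generalize ρ q = v at *
  generalize ρ 0 = m at *
  have hE : (x - b * u - a * v + a * b * m) ^ 2 - x ^ 2 =
      2 * x * (-(b * u)) + 2 * x * (-(a * v)) + 2 * x * (a * b * m) +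
        (-(b * u) - a * v + a * b * m) ^ 2 := by ring
  have ha2 : a ^ 2 ≤ a := by nlinarith
  have hb2 : b ^ 2 ≤ b := by nlinarith
  have hab : (a * b) ^ 2 ≤ a * b := by nlinarith [mul_pos ha0 hb0, mul_le_one₀ ha1 hb0.le hb1]
  have t1 : |2 * x * (-(b * u))| ≤ b * (x ^ 2 + u ^ 2) := by
    rw [abs_le]; constructor <;> nlinarith [mul_nonneg hb0.le (sq_nonneg (x - u)),
      mul_nonneg hb0.le (sq_nonneg (x + u))]
  have t2 : |2 * x * (-(a * v))| ≤ a * (x ^ 2 + v ^ 2) := by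
    rw [abs_le]; constructor <;> nlinarith [mul_nonneg ha0.le (sq_nonneg (x - v)),
      mul_nonneg ha0.le (sq_nonneg (x + v))]
  have t3 : |2 * x * (a * b * m)| ≤ a * (x ^ 2 + b * m ^ 2) := by
    have hbm : b ^ 2 * m ^ 2 ≤ b * m ^ 2 := mul_le_mul_of_nonneg_right hb2 (sq_nonneg m)
    have hbm' := mul_le_mul_of_nonneg_left hbm ha0.le
    rw [abs_le]; constructor <;> nlinarith [mul_nonneg ha0.le (sq_nonneg (x - b * m)),
      mul_nonneg ha0.le (sq_nonneg (x + b * m))]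
  have t4 : |(-(b * u) - a * v + a * b * m) ^ 2| ≤
      3 * (b * u ^ 2 + a * v ^ 2 + a * b * m ^ 2) := by
    rw [abs_of_nonneg (sq_nonneg _)]
    have k1 := mul_le_mul_of_nonneg_right hb2 (sq_nonneg u)
    have k2 := mul_le_mul_of_nonneg_right ha2 (sq_nonneg v)
    have k3 := mul_le_mul_of_nonneg_right hab (sq_nonneg m)
    nlinarith [sq_nonneg (b * u - a * v), sq_nonneg (b * u + a * b * m),
      sq_nonneg (a * v + a * b * m)]
  rw [hE]
  refine (abs_add_le _ _).trans ((add_le_add ((abs_add_le _ _).trans (add_le_add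
    ((abs_add_le _ _).trans (add_le_add t1 t2)) t3)) t4).trans ?_)
  nlinarith [mul_nonneg hb0.le (sq_nonneg x), mul_nonneg (mul_pos ha0 hb0).le (sq_nonneg m)]

/-- The factor $e^{-r}$ has integral at most $1$, so the double integral costs no more than the
worst inner one: $2\cdot2G(T)+4G(T)+4\rho(0)^2$ with $G$ = `sqPrimitive ρ`. -/
theorem integral_startedError_le (hc : Continuous ρ) (he : ∀ x, ρ (-x) = ρ x) (hT : 0 ≤ T) :
    ∫ r in (0 : ℝ)..T, ∫ q in (0 : ℝ)..T, startedError ρ r q ≤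
      8 * sqPrimitive ρ T + 4 * ρ 0 ^ 2 := by
  have hG := sqPrimitive_nonneg (ρ := ρ) hT
  have h1 : ∀ r ∈ Icc 0 T, ∫ q in (0 : ℝ)..T, startedError ρ r q ≤
      Real.exp (-r) * (8 * sqPrimitive ρ T + 4 * ρ 0 ^ 2) := by
    intro r hr
    simp only [startedError]
    rw [intervalIntegral.integral_const_mul]
    refine mul_le_mul_of_nonneg_left ?_ (Real.exp_pos _).le
    have c1 : Continuous fun q => 2 * ρ (r - q) ^ 2 := by fun_prop
    have c2 : Continuous fun q => 4 * ρ q ^ 2 := by fun_prop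
    have c12 : Continuous fun q => 2 * ρ (r - q) ^ 2 + 4 * ρ q ^ 2 := by fun_prop
    have c3 : Continuous fun q : ℝ => 4 * ρ 0 ^ 2 * Real.exp (-q) := by fun_prop
    rw [intervalIntegral.integral_add (c12.intervalIntegrable _ _)
      (c3.intervalIntegrable _ _), intervalIntegral.integral_add (c1.intervalIntegrable _ _)
      (c2.intervalIntegrable _ _), intervalIntegral.integral_const_mul,
      intervalIntegral.integral_const_mul, intervalIntegral.integral_const_mul]
    have k1 := integral_sub_sq_le hc he hr
    have k2 := mul_le_mul_of_nonneg_left (integral_exp_neg_le T)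
      (by positivity : 0 ≤ 4 * ρ 0 ^ 2)
    have k3 : ∫ q in (0 : ℝ)..T, ρ q ^ 2 = sqPrimitive ρ T := rfl
    linarith
  have hcont : Continuous fun r => ∫ q in (0 : ℝ)..T, startedError ρ r q :=
    intervalIntegral.continuous_parametric_intervalIntegral_of_continuous'
      (continuous_startedError hc) 0 T
  calc _ ≤ ∫ r in (0 : ℝ)..T, Real.exp (-r) * (8 * sqPrimitive ρ T + 4 * ρ 0 ^ 2) :=
        intervalIntegral.integral_mono_on hT (hcont.intervalIntegrable _ _)
          ((by fun_prop : Continuous _).intervalIntegrable _ _) h1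
    _ = (∫ r in (0 : ℝ)..T, Real.exp (-r)) * (8 * sqPrimitive ρ T + 4 * ρ 0 ^ 2) :=
        intervalIntegral.integral_mul_const _ _
    _ ≤ 1 * (8 * sqPrimitive ρ T + 4 * ρ 0 ^ 2) :=
        mul_le_mul_of_nonneg_right (integral_exp_neg_le T) (by positivity)
    _ = _ := one_mul _

theorem integral_integral_swap_of_continuous {F : ℝ → ℝ → ℝ}
    (hF : Continuous (Function.uncurry F)) (T : ℝ) :
    ∫ r in (0 : ℝ)..T, ∫ q in (0 : ℝ)..T, F r q =
      ∫ q in (0 : ℝ)..T, ∫ r in (0 : ℝ)..T, F r q := by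
  refine intervalIntegral_intervalIntegral_swap ?_
  exact (hF.continuousOn.integrableOn_compact (isCompact_uIcc.prod isCompact_uIcc)).mono_set
    (prod_mono uIoc_subset_uIcc uIoc_subset_uIcc)

theorem abs_integral_startedCov_sq_sub_le (hc : Continuous ρ) (he : ∀ x, ρ (-x) = ρ x)
    (hT : 0 ≤ T) :
    |(∫ r in (0 : ℝ)..T, ∫ q in (0 : ℝ)..T, startedCov ρ r q ^ 2) -
      2 * ∫ r in (0 : ℝ)..T, sqPrimitive ρ r| ≤ 16 * sqPrimitive ρ T + 8 * ρ 0 ^ 2 := by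
  have hK : Continuous (Function.uncurry fun r q => startedCov ρ r q ^ 2) :=
    (continuous_startedCov hc).pow 2
  have hR : Continuous (Function.uncurry fun r q => ρ (r - q) ^ 2) := by
    unfold Function.uncurry; fun_prop
  have hE := continuous_startedError hc
  have hE' : Continuous (Function.uncurry fun r q => startedError ρ q r) :=
    hE.comp continuous_swap
  have hEE : Continuous (Function.uncurry fun r q => startedError ρ r q + startedError ρ q r) :=
    hE.add hE'
  have par := fun {F : ℝ → ℝ → ℝ} (hF : Continuous (Function.uncurry F)) =>
    intervalIntegral.continuous_parametric_intervalIntegral_of_continuous' (μ := volume) hF 0 T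
  have sec := fun {F : ℝ → ℝ → ℝ} (hF : Continuous (Function.uncurry F)) (r : ℝ) =>
    hF.comp (by fun_prop : Continuous fun q : ℝ => (r, q))
  rw [← integral_integral_sub_sq hc he]
  refine (abs_integral_sub_integral_le (par hK) (par hR) (par hEE) hT fun r hr =>
    abs_integral_sub_integral_le (sec hK r) (sec hR r) (sec hEE r) hT fun q hq =>
      abs_startedCov_sq_sub_le he hr.1 hq.1).trans ?_
  have hsplit : ∀ r, ∫ q in (0 : ℝ)..T, (startedError ρ r q + startedError ρ q r) =
      (∫ q in (0 : ℝ)..T, startedError ρ r q) + ∫ q in (0 : ℝ)..T, startedError ρ q r := fun r =>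
    intervalIntegral.integral_add ((sec hE r).intervalIntegrable _ _)
      ((sec hE' r).intervalIntegrable _ _)
  simp only [hsplit]
  rw [intervalIntegral.integral_add ((par hE).intervalIntegrable _ _)
    ((par hE').intervalIntegrable _ _), integral_integral_swap_of_continuous hE']
  have h := integral_startedError_le hc he hT
  linarith

theorem startedCov_comm (he : ∀ x, ρ (-x) = ρ x) (t s : ℝ) :
    startedCov ρ t s = startedCov ρ s t := by
  have hx : ρ (t - s) = ρ (s - t) := by rw [← he, neg_sub]
  rw [startedCov, startedCov, hx]
  ring

/-- Meant for the boundary terms, where $r=T$ is fixed and only $q$ is integrated. There $\rho(r)^2$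
gains nothing from integration and is replaced by $\rho(0)^2$, with $e^{-q}$ kept to make the
integral bounded. -/
theorem startedCov_sq_le {r q : ℝ} (hr : 0 ≤ r) (hq : 0 ≤ q) (hb : ∀ x, |ρ x| ≤ ρ 0) :
    startedCov ρ r q ^ 2 ≤ 4 * ρ (r - q) ^ 2 + 4 * ρ q ^ 2 + 8 * ρ 0 ^ 2 * Real.exp (-q) := by
  have ha0 := Real.exp_pos (-r)
  have hb0 := Real.exp_pos (-q)
  have ha1 : Real.exp (-r) ≤ 1 := Real.exp_le_one_iff.2 (by linarith)
  have hb1 : Real.exp (-q) ≤ 1 := Real.exp_le_one_iff.2 (by linarith)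
  have hu : ρ r ^ 2 ≤ ρ 0 ^ 2 := sq_le_sq' (by linarith [(abs_le.1 (hb r)).1]) (abs_le.1 (hb r)).2
  simp only [startedCov]
  generalize Real.exp (-r) = a at *
  generalize Real.exp (-q) = b at *
  generalize ρ (r - q) = x at *
  generalize ρ r = u at *
  generalize ρ q = v at *
  generalize ρ 0 = m at *
  have h4 : (x - b * u - a * v + a * b * m) ^ 2 ≤
      4 * (x ^ 2 + (b * u) ^ 2 + (a * v) ^ 2 + (a * b * m) ^ 2) := by
    nlinarith [sq_nonneg (x + b * u), sq_nonneg (x + a * v), sq_nonneg (x - a * b * m),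
      sq_nonneg (b * u - a * v), sq_nonneg (b * u + a * b * m), sq_nonneg (a * v + a * b * m)]
  have hb2 : b ^ 2 ≤ b := by nlinarith
  have ha2 : a ^ 2 ≤ 1 := by nlinarith
  have k1 : (b * u) ^ 2 ≤ b * m ^ 2 := by
    rw [mul_pow]; exact mul_le_mul hb2 hu (sq_nonneg _) hb0.le
  have k2 : (a * v) ^ 2 ≤ v ^ 2 := by
    rw [mul_pow]; exact mul_le_of_le_one_left (sq_nonneg _) ha2
  have k3 : (a * b * m) ^ 2 ≤ b * m ^ 2 := by
    rw [mul_pow, mul_pow]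
    refine mul_le_mul_of_nonneg_right ?_ (sq_nonneg _)
    nlinarith [mul_le_mul_of_nonneg_right ha2 (sq_nonneg b)]
  linarith

theorem integral_startedCov_sq_le (hc : Continuous ρ) (he : ∀ x, ρ (-x) = ρ x)
    (hb : ∀ x, |ρ x| ≤ ρ 0) (hT : 0 ≤ T) :
    ∫ q in (0 : ℝ)..T, startedCov ρ T q ^ 2 ≤ 12 * sqPrimitive ρ T + 8 * ρ 0 ^ 2 := by
  have c0 : Continuous fun q => startedCov ρ T q ^ 2 := by unfold startedCov; fun_prop
  have c1 : Continuous fun q => 4 * ρ (T - q) ^ 2 := by fun_prop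
  have c2 : Continuous fun q => 4 * ρ q ^ 2 := by fun_prop
  have c12 : Continuous fun q => 4 * ρ (T - q) ^ 2 + 4 * ρ q ^ 2 := by fun_prop
  have c3 : Continuous fun q : ℝ => 8 * ρ 0 ^ 2 * Real.exp (-q) := by fun_prop
  refine (intervalIntegral.integral_mono_on hT (c0.intervalIntegrable _ _)
    ((c12.add c3).intervalIntegrable _ _)
    (fun q hq => startedCov_sq_le hT hq.1 hb)).trans ?_
  simp only [Pi.add_apply]
  rw [intervalIntegral.integral_add (c12.intervalIntegrable _ _)
    (c3.intervalIntegrable _ _), intervalIntegral.integral_add (c1.intervalIntegrable _ _)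
    (c2.intervalIntegrable _ _), intervalIntegral.integral_const_mul,
    intervalIntegral.integral_const_mul, intervalIntegral.integral_const_mul]
  have k1 := integral_sub_sq_le hc he (right_mem_Icc.2 hT)
  have k2 := mul_le_mul_of_nonneg_left (integral_exp_neg_le T) (by positivity : 0 ≤ 8 * ρ 0 ^ 2)
  have k3 : ∫ q in (0 : ℝ)..T, ρ q ^ 2 = sqPrimitive ρ T := rfl
  linarith

theorem abs_startedEnergy_sub_le (hc : Continuous ρ) (he : ∀ x, ρ (-x) = ρ x)
    (hb : ∀ x, |ρ x| ≤ ρ 0) (hT : 0 ≤ T) :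
    |startedEnergy ρ T - 8 * ∫ r in (0 : ℝ)..T, sqPrimitive ρ r| ≤
      112 * (sqPrimitive ρ T + ρ 0 ^ 2) := by
  have hK : Continuous (Function.uncurry fun r q => startedCov ρ r q ^ 2) :=
    (continuous_startedCov hc).pow 2
  have c1 : Continuous fun r => 2 * ∫ q in (0 : ℝ)..T, startedCov ρ r q ^ 2 :=
    continuous_const.mul
      (intervalIntegral.continuous_parametric_intervalIntegral_of_continuous' hK 0 T)
  have c2 : Continuous fun r => startedCov ρ r T ^ 2 :=
    hK.comp (by fun_prop : Continuous fun r : ℝ => (r, T))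
  have hsym : ∫ r in (0 : ℝ)..T, startedCov ρ r T ^ 2 = ∫ q in (0 : ℝ)..T, startedCov ρ T q ^ 2 := by
    simp only [startedCov_comm he T]
  have hN : startedEnergy ρ T = 4 * (∫ r in (0 : ℝ)..T, ∫ q in (0 : ℝ)..T, startedCov ρ r q ^ 2) +
      4 * (∫ q in (0 : ℝ)..T, startedCov ρ T q ^ 2) + startedCov ρ T T ^ 2 := by
    rw [startedEnergy, intervalIntegral.integral_add (c1.intervalIntegrable _ _)
      (c2.intervalIntegrable _ _), hsym, intervalIntegral.integral_const_mul]
    ring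
  have h1 := abs_le.1 (abs_integral_startedCov_sq_sub_le hc he hT)
  have h2 := integral_startedCov_sq_le hc he hb hT
  have h2' : 0 ≤ ∫ q in (0 : ℝ)..T, startedCov ρ T q ^ 2 :=
    intervalIntegral.integral_nonneg hT fun _ _ => sq_nonneg _
  have h3 := startedCov_sq_le hT hT hb
  have h3' := sq_nonneg (startedCov ρ T T)
  have hv : ρ T ^ 2 ≤ ρ 0 ^ 2 := sq_le_sq' (by linarith [(abs_le.1 (hb T)).1]) (abs_le.1 (hb T)).2
  have hx : Real.exp (-T) ≤ 1 := Real.exp_le_one_iff.2 (by linarith)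
  have hx2 := mul_le_mul_of_nonneg_left hx (by positivity : 0 ≤ 8 * ρ 0 ^ 2)
  have hG := sqPrimitive_nonneg (ρ := ρ) hT
  rw [sub_self] at h3
  rw [hN, abs_le]
  -- The coefficient of `sqPrimitive ρ T` is $4\cdot16+4\cdot12=112$; that of $\rho(0)^2$ is
  -- $4\cdot8+4\cdot8+16=80\le112$.
  constructor <;> linarith

end Asymptotics

/-! ### Convergence rate of the energy under power decay of the covariance -/

section Rate

variable {ρ : ℝ → ℝ} {A β : ℝ}

theorem sq_le_of_decay (hdec : ∀ x, 0 < x → |ρ x| ≤ A * x ^ (-β)) {x : ℝ} (hx : 0 < x) :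
    ρ x ^ 2 ≤ A ^ 2 * x ^ (-(2 * β)) := by
  calc ρ x ^ 2 = |ρ x| ^ 2 := (sq_abs _).symm
    _ ≤ (A * x ^ (-β)) ^ 2 := pow_le_pow_left₀ (abs_nonneg _) (hdec x hx) 2
    _ = _ := by
      rw [mul_pow, ← Real.rpow_mul_natCast hx.le]
      congr 2
      push_cast
      ring

theorem integrableOn_sq_of_decay (hc : Continuous ρ)
    (hdec : ∀ x, 0 < x → |ρ x| ≤ A * x ^ (-β)) (hβ : 1 < 2 * β) :
    IntegrableOn (fun x => ρ x ^ 2) (Ioi 0) := by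
  rw [← Ioc_union_Ioi_eq_Ioi zero_le_one]
  refine IntegrableOn.union ?_ ?_
  · exact ((hc.pow 2).continuousOn.integrableOn_compact isCompact_Icc).mono_set Ioc_subset_Icc_self
  · refine Integrable.mono' ((integrableOn_Ioi_rpow_of_lt (by linarith : -(2 * β) < -1)
      one_pos).const_mul (A ^ 2)) (hc.pow 2).aestronglyMeasurable
      ((ae_restrict_iff' measurableSet_Ioi).2 (Filter.Eventually.of_forall fun x hx => ?_))
    rw [Real.norm_of_nonneg (sq_nonneg _)]
    exact sq_le_of_decay hdec (one_pos.trans hx)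

theorem integral_Ioi_sub_sqPrimitive (hi : IntegrableOn (fun x => ρ x ^ 2) (Ioi 0)) {r : ℝ}
    (hr : 0 ≤ r) : (∫ x in Ioi (0 : ℝ), ρ x ^ 2) - sqPrimitive ρ r = ∫ x in Ioi r, ρ x ^ 2 := by
  rw [← Ioc_union_Ioi_eq_Ioi hr, setIntegral_union (Ioc_disjoint_Ioi le_rfl) measurableSet_Ioi
    (hi.mono_set Ioc_subset_Ioi_self) (hi.mono_set (Ioi_subset_Ioi hr)), sqPrimitive,
    intervalIntegral.integral_of_le hr]
  ring

theorem integral_Ioi_sq_le (hi : IntegrableOn (fun x => ρ x ^ 2) (Ioi 0))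
    (hdec : ∀ x, 0 < x → |ρ x| ≤ A * x ^ (-β)) (hβ : 1 < 2 * β) {r : ℝ} (hr : 0 < r) :
    ∫ x in Ioi r, ρ x ^ 2 ≤ A ^ 2 / (2 * β - 1) * r ^ (1 - 2 * β) := by
  have h := setIntegral_mono_on (hi.mono_set (Ioi_subset_Ioi hr.le))
    ((integrableOn_Ioi_rpow_of_lt (by linarith : -(2 * β) < -1) hr).const_mul (A ^ 2))
    measurableSet_Ioi fun x hx => sq_le_of_decay hdec (hr.trans hx)
  refine h.trans (le_of_eq ?_)
  rw [integral_const_mul, integral_Ioi_rpow_of_lt (by linarith) hr,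
    show -(2 * β) + 1 = 1 - 2 * β by ring]
  have h1 : 1 - 2 * β ≠ 0 := by linarith
  have h2 : 2 * β - 1 ≠ 0 := by linarith
  field_simp
  ring

/-- On $[0,1]$ the tail is at most the full integral; on $[1,T]$ it is at most a multiple of
$r^{1-2\beta}$. The integral of this power is bounded for $\beta>1$ and of order $T^{2-2\beta}$ for
$\beta<1$; $\beta=1$ would give $\log T$. -/
theorem integral_tail_le (hc : Continuous ρ) (hdec : ∀ x, 0 < x → |ρ x| ≤ A * x ^ (-β))
    (hβ : 1 < 2 * β) (hβ2 : β ≠ 1) {T : ℝ} (hT : 1 ≤ T) :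
    ∫ r in (0 : ℝ)..T, ((∫ x in Ioi (0 : ℝ), ρ x ^ 2) - sqPrimitive ρ r) ≤
      ((∫ x in Ioi (0 : ℝ), ρ x ^ 2) + A ^ 2 / (2 * β - 1) / |2 - 2 * β|) *
        T ^ (1 - min 1 (2 * β - 1)) := by
  have hi := integrableOn_sq_of_decay hc hdec hβ
  set S := ∫ x in Ioi (0 : ℝ), ρ x ^ 2 with hS
  have hS0 : 0 ≤ S := setIntegral_nonneg measurableSet_Ioi fun _ _ => sq_nonneg _
  have hT0 : 0 < T := by linarith
  have hcont : Continuous fun r => S - sqPrimitive ρ r :=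
    continuous_const.sub (continuous_sqPrimitive hc)
  have hpow : 1 ≤ T ^ (1 - min 1 (2 * β - 1)) :=
    Real.one_le_rpow hT (by linarith [min_le_left 1 (2 * β - 1)])
  have hB : 0 ≤ A ^ 2 / (2 * β - 1) := div_nonneg (sq_nonneg _) (by linarith)
  have h1 : ∫ r in (0 : ℝ)..1, (S - sqPrimitive ρ r) ≤ S := by
    have h := intervalIntegral.integral_mono_on zero_le_one
      (hcont.intervalIntegrable (μ := volume) 0 1)
      ((continuous_const (y := S)).intervalIntegrable (μ := volume) 0 1)
      (fun r hr => by linarith [sqPrimitive_nonneg (ρ := ρ) hr.1])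
    simpa using h
  have hne : 2 - 2 * β ≠ 0 := fun h => hβ2 (by linarith)
  have hnot : (0 : ℝ) ∉ uIcc 1 T := by
    rw [uIcc_of_le hT]; exact fun h => absurd h.1 (by norm_num)
  have h2 : ∫ r in (1 : ℝ)..T, (S - sqPrimitive ρ r) ≤
      A ^ 2 / (2 * β - 1) * ((T ^ (2 - 2 * β) - 1) / (2 - 2 * β)) := by
    have h := intervalIntegral.integral_mono_on hT (hcont.intervalIntegrable (μ := volume) 1 T)
      ((intervalIntegral.intervalIntegrable_rpow (μ := volume) (r := 1 - 2 * β)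
        (Or.inr hnot)).const_mul (A ^ 2 / (2 * β - 1))) (fun r hr => by
          have hr0 : 0 < r := by linarith [hr.1]
          rw [hS, integral_Ioi_sub_sqPrimitive hi hr0.le]
          exact integral_Ioi_sq_le hi hdec hβ hr0)
    rw [intervalIntegral.integral_const_mul, integral_rpow
      (Or.inr ⟨by intro h; apply hne; linarith, hnot⟩),
      show 1 - 2 * β + 1 = 2 - 2 * β by ring, Real.one_rpow] at h
    exact h
  have h3 : (T ^ (2 - 2 * β) - 1) / (2 - 2 * β) ≤
      T ^ (1 - min 1 (2 * β - 1)) / |2 - 2 * β| := by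
    rcases lt_or_gt_of_ne hne with h | h
    · rw [abs_of_neg h, ← neg_div_neg_eq]
      refine div_le_div_of_nonneg_right ?_ (by linarith)
      linarith [Real.rpow_nonneg hT0.le (2 - 2 * β)]
    · rw [abs_of_pos h, min_eq_right (by linarith)]
      refine div_le_div_of_nonneg_right ?_ h.le
      rw [show 1 - (2 * β - 1) = 2 - 2 * β by ring]
      linarith
  rw [← intervalIntegral.integral_add_adjacent_intervals (hcont.intervalIntegrable 0 1)
    (hcont.intervalIntegrable 1 T)]
  calc _ ≤ S * 1 + A ^ 2 / (2 * β - 1) * (T ^ (1 - min 1 (2 * β - 1)) / |2 - 2 * β|) := by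
        rw [mul_one]; exact add_le_add h1 (h2.trans (mul_le_mul_of_nonneg_left h3 hB))
    _ ≤ S * T ^ (1 - min 1 (2 * β - 1)) +
        A ^ 2 / (2 * β - 1) * (T ^ (1 - min 1 (2 * β - 1)) / |2 - 2 * β|) := by
        gcongr
    _ = _ := by ring

theorem abs_startedEnergy_div_sub_le (hc : Continuous ρ) (he : ∀ x, ρ (-x) = ρ x)
    (hb : ∀ x, |ρ x| ≤ ρ 0) (hdec : ∀ x, 0 < x → |ρ x| ≤ A * x ^ (-β)) (hβ : 1 < 2 * β)
    (hβ2 : β ≠ 1) :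
    ∃ C : ℝ, 0 ≤ C ∧ ∀ T, 1 ≤ T →
      |1 / (2 * T) * startedEnergy ρ T - 4 * ∫ x in Ioi (0 : ℝ), ρ x ^ 2| ≤
        C / T ^ (min 1 (2 * β - 1)) := by
  have hi := integrableOn_sq_of_decay hc hdec hβ
  set S := ∫ x in Ioi (0 : ℝ), ρ x ^ 2 with hS
  have hS0 : 0 ≤ S := setIntegral_nonneg measurableSet_Ioi fun _ _ => sq_nonneg _
  have hB : 0 ≤ A ^ 2 / (2 * β - 1) := div_nonneg (sq_nonneg _) (by linarith)
  -- Half of the error constant $112$, plus $8/2=4$ times the constant of `integral_tail_le`.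
  refine ⟨56 * (S + ρ 0 ^ 2) + 4 * (S + A ^ 2 / (2 * β - 1) / |2 - 2 * β|), by positivity,
    fun T hT => ?_⟩
  have hT0 : 0 < T := by linarith
  set I := ∫ r in (0 : ℝ)..T, sqPrimitive ρ r with hI
  have hG : sqPrimitive ρ T ≤ S := by
    have h := integral_Ioi_sub_sqPrimitive hi hT0.le
    have h' : 0 ≤ ∫ x in Ioi T, ρ x ^ 2 :=
      setIntegral_nonneg measurableSet_Ioi fun _ _ => sq_nonneg _
    linarith
  have h1 := abs_startedEnergy_sub_le hc he hb hT0.le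
  have h2 := integral_tail_le hc hdec hβ hβ2 hT
  have h2' : 0 ≤ ∫ r in (0 : ℝ)..T, (S - sqPrimitive ρ r) :=
    intervalIntegral.integral_nonneg hT0.le fun r hr => by
      rw [hS, integral_Ioi_sub_sqPrimitive hi hr.1]
      exact setIntegral_nonneg measurableSet_Ioi fun _ _ => sq_nonneg _
  have h3 : ∫ r in (0 : ℝ)..T, (S - sqPrimitive ρ r) = T * S - I := by
    rw [intervalIntegral.integral_sub (continuous_const.intervalIntegrable _ _)
      ((continuous_sqPrimitive hc).intervalIntegrable _ _), intervalIntegral.integral_const,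
      sub_zero, smul_eq_mul]
  rw [← hS] at h2
  rw [h3] at h2 h2'
  set P := T ^ (1 - min 1 (2 * β - 1)) with hP
  have hP1 : 1 ≤ P := Real.one_le_rpow hT (by linarith [min_le_left 1 (2 * β - 1)])
  have hPT : P / T = 1 / T ^ (min 1 (2 * β - 1)) := by
    rw [hP, Real.rpow_sub hT0, Real.rpow_one]
    field_simp
  have hid : 1 / (2 * T) * startedEnergy ρ T - 4 * S =
      ((startedEnergy ρ T - 8 * I) / 2 - 4 * (T * S - I)) / T := by
    field_simp
    ring
  rw [hid, abs_div, abs_of_pos hT0, div_eq_mul_one_div _ (T ^ (min 1 (2 * β - 1))), ← hPT,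
    ← mul_div_assoc]
  refine div_le_div_of_nonneg_right ?_ hT0.le
  have h4 := abs_le.1 h1
  have h5 : 56 * (S + ρ 0 ^ 2) ≤ 56 * (S + ρ 0 ^ 2) * P := le_mul_of_one_le_right (by positivity) hP1
  rw [abs_le]
  constructor <;> linarith

end Rate

/-! ### The rate of convergence for the fractional Ornstein-Uhlenbeck process -/

section Main

theorem exists_rate {H : ℝ} (h0 : 0 < H) (h1 : H < 3 / 4) :
    ∃ C : ℝ, 0 ≤ C ∧ ∀ T, 1 ≤ T →
      |1 / (2 * T) * startedEnergy (ouCov H) T - sigmaSq H| ≤ C / T ^ (min 1 (3 - 4 * H)) := by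
  have hH1 : H < 1 := by linarith
  rw [← four_mul_integral_ouCov_sq h0 h1]
  -- The generic exponent $\beta=2-2H$ equals the excluded value $1$ exactly at $H=\frac12$. There
  -- $\beta=2$ is used instead, and both minima in the exponent equal $1$.
  rcases eq_or_ne H (1 / 2) with rfl | h
  · obtain ⟨C, hC, hb⟩ := abs_startedEnergy_div_sub_le (A := 3) (β := 2)
      (continuous_ouCov h0 hH1) (ouCov_neg _) (abs_ouCov_le_zero h0 hH1)
      (fun x hx => abs_ouCov_half_le hx) (by norm_num) (by norm_num)
    refine ⟨C, hC, fun T hT => ?_⟩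
    have h := hb T hT
    norm_num at h ⊢
    exact h
  · obtain ⟨C, hC, hb⟩ := abs_startedEnergy_div_sub_le (A := 1) (β := 2 - 2 * H)
      (continuous_ouCov h0 hH1) (ouCov_neg _) (abs_ouCov_le_zero h0 hH1)
      (fun x hx => by
        rw [one_mul, show -(2 - 2 * H) = 2 * H - 2 by ring]; exact abs_ouCov_le h0 hH1 hx)
      (by linarith) (fun h' => h (by linarith))
    refine ⟨C, hC, fun T hT => ?_⟩
    rw [show 3 - 4 * H = 2 * (2 - 2 * H) - 1 by ring]
    exact hb T hT

theorem sqPrimitive_ouCov_le {H : ℝ} (h1 : 3 / 4 < H) (hH1 : H < 1) {T : ℝ} (hT : 0 < T) :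
    sqPrimitive (ouCov H) T ≤ T ^ (4 * H - 3) / (4 * H - 3) := by
  have h0 : 0 < H := by linarith
  have hr : IntervalIntegrable (fun x : ℝ => x ^ (4 * H - 4)) volume 0 T :=
    intervalIntegral.intervalIntegrable_rpow' (by linarith)
  have h := intervalIntegral.integral_mono_on_of_le_Ioo hT.le
    (((continuous_ouCov h0 hH1).pow 2).intervalIntegrable (μ := volume) 0 T) hr
    (fun x hx => by
      have hd := sq_le_of_decay (ρ := ouCov H) (A := 1) (β := 2 - 2 * H)
        (fun x hx => by
          rw [one_mul, show -(2 - 2 * H) = 2 * H - 2 by ring]; exact abs_ouCov_le h0 hH1 hx) hx.1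
      rwa [one_pow, one_mul, show -(2 * (2 - 2 * H)) = 4 * H - 4 by ring] at hd)
  rw [integral_rpow (Or.inl (by linarith)), show 4 * H - 4 + 1 = 4 * H - 3 by ring,
    Real.zero_rpow (by linarith), sub_zero] at h
  exact h

/-- Nothing converges here: the energy divided by $2T$ is bounded by a multiple of $T^{4H-3}$ plus a
constant. Constants are absorbed because $T^{4H-3}\ge T_0^{4H-3}$, which is why $T$ must stay away
from $0$. -/
theorem exists_rate_of_gt {H : ℝ} (h1 : 3 / 4 < H) (hH1 : H < 1) {T₀ : ℝ} (hT₀ : 0 < T₀) :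
    ∃ C : ℝ, 0 ≤ C ∧ ∀ T, T₀ ≤ T →
      |1 / (2 * T) * startedEnergy (ouCov H) T - sigmaSq H| ≤ C / T ^ (min 1 (3 - 4 * H)) := by
  have h0 : 0 < H := by linarith
  have hp : 0 < 4 * H - 3 := by linarith
  set m := ouCov H 0 ^ 2 with hm
  have hm0 : 0 ≤ m := sq_nonneg _
  have hP0 : 0 < T₀ ^ (4 * H - 3) := Real.rpow_pos_of_pos hT₀ _
  -- With $Q=T^{4H-3}/(4H-3)$, the first summand collects $8TQ/(2T)=4Q$ and $112Q/(2T)\le56Q/T_0$.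
  -- The second absorbs the terms that do not grow.
  refine ⟨(4 + 56 / T₀) / (4 * H - 3) + (56 * m / T₀ + |sigmaSq H|) / T₀ ^ (4 * H - 3),
    by positivity, fun T hT => ?_⟩
  have hT0 : 0 < T := hT₀.trans_le hT
  set P := T ^ (4 * H - 3) with hP
  have hPP : T₀ ^ (4 * H - 3) ≤ P := Real.rpow_le_rpow hT₀.le hT hp.le
  have hG := sqPrimitive_ouCov_le h1 hH1 hT0
  have hc := continuous_ouCov h0 hH1
  have hI : ∫ r in (0 : ℝ)..T, sqPrimitive (ouCov H) r ≤ T * (P / (4 * H - 3)) := by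
    have h := intervalIntegral.integral_mono_on hT0.le
      ((continuous_sqPrimitive hc).intervalIntegrable (μ := volume) 0 T)
      ((continuous_const (y := P / (4 * H - 3))).intervalIntegrable (μ := volume) 0 T)
      (fun r hr => (sqPrimitive_mono hc hr.2).trans hG)
    rwa [intervalIntegral.integral_const, sub_zero, smul_eq_mul] at h
  have hI0 : 0 ≤ ∫ r in (0 : ℝ)..T, sqPrimitive (ouCov H) r :=
    intervalIntegral.integral_nonneg hT0.le fun r hr => sqPrimitive_nonneg hr.1
  have hN := abs_startedEnergy_sub_le hc (ouCov_neg H) (abs_ouCov_le_zero h0 hH1) hT0.le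
  rw [← hm] at hN
  set N := startedEnergy (ouCov H) T
  set Q := P / (4 * H - 3) with hQ
  have hQ0 : 0 ≤ Q := by positivity
  have hNabs : |N| ≤ 8 * (T * Q) + 112 * (Q + m) := by
    have := abs_le.1 hN
    rw [abs_le]
    constructor <;> linarith [mul_nonneg hT0.le hQ0]
  rw [min_eq_right (by linarith), show 3 - 4 * H = -(4 * H - 3) by ring,
    Real.rpow_neg hT0.le, div_inv_eq_mul, ← hP]
  have hA : |1 / (2 * T) * N| ≤ 4 * Q + 56 / T₀ * Q + 56 * m / T₀ := by
    rw [abs_mul, abs_of_pos (by positivity : 0 < 1 / (2 * T))]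
    calc _ ≤ 1 / (2 * T) * (8 * (T * Q) + 112 * (Q + m)) :=
          mul_le_mul_of_nonneg_left hNabs (by positivity)
      _ = 4 * Q + (56 * Q / T + 56 * m / T) := by field_simp; ring
      _ ≤ 4 * Q + (56 * Q / T₀ + 56 * m / T₀) := by gcongr
      _ = _ := by ring
  have hB : 56 * m / T₀ + |sigmaSq H| ≤ (56 * m / T₀ + |sigmaSq H|) / T₀ ^ (4 * H - 3) * P := by
    rw [div_mul_eq_mul_div, le_div_iff₀ hP0]
    exact mul_le_mul_of_nonneg_left hPP (by positivity)
  calc _ ≤ |1 / (2 * T) * N| + |sigmaSq H| := abs_sub _ _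
    _ ≤ (4 * Q + 56 / T₀ * Q) + (56 * m / T₀ + |sigmaSq H|) := by linarith
    _ ≤ (4 * Q + 56 / T₀ * Q) + (56 * m / T₀ + |sigmaSq H|) / T₀ ^ (4 * H - 3) * P := by linarith
    _ = _ := by rw [hQ]; ring

theorem startedEnergy_ouCov_eq (H : Ioo (0 : ℝ) 1) {T : ℝ} (hT : 0 ≤ T) {h : TensorSquare H T}
    (hh : IsElement H T (fT T) h) : ‖h‖ ^ 2 = startedEnergy (ouCov H) T := by
  rw [hh.unique H (isElement_fTElement H hT), norm_sq_fTElement, startedEnergy]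

/-- For $T<1$ the difference need not be small: $1\le T^{-\gamma}$ handles $\sigma^2$, and
$T^{4H-1}\le T^{-\gamma}$ handles the energy because $4H-1\ge-\gamma$ for $\gamma=1\wedge(3-4H)$.
The constant $72$ is half of $144$ in `norm_sq_fTElement_le`. -/
theorem exists_rate_all (H : Ioo (0 : ℝ) 1) (h1 : (H : ℝ) < 3 / 4) :
    ∃ C : ℝ, 0 < C ∧ ∀ T, 0 < T →
      |1 / (2 * T) * startedEnergy (ouCov H) T - sigmaSq H| ≤
        C / T ^ (min 1 (3 - 4 * (H : ℝ))) := by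
  have h0 : 0 < (H : ℝ) := H.2.1
  obtain ⟨C, hC, hb⟩ := exists_rate h0 h1
  refine ⟨C + (72 + |sigmaSq H|) + 1, by positivity, fun T hT => ?_⟩
  set γ := min 1 (3 - 4 * (H : ℝ)) with hγ
  have hγ0 : 0 < γ := lt_min one_pos (by linarith)
  have hTγ : 0 < T ^ γ := Real.rpow_pos_of_pos hT _
  rcases le_or_gt 1 T with hT1 | hT1
  · refine (hb T hT1).trans (div_le_div_of_nonneg_right ?_ hTγ.le)
    linarith [abs_nonneg (sigmaSq H)]
  · have hN : startedEnergy (ouCov H) T ≤ 144 * T ^ (4 * (H : ℝ)) := by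
      rw [← startedEnergy_ouCov_eq H hT.le (isElement_fTElement H hT.le)]
      exact norm_sq_fTElement_le H hT.le hT1.le
    have hN0 : 0 ≤ startedEnergy (ouCov H) T := by
      rw [← startedEnergy_ouCov_eq H hT.le (isElement_fTElement H hT.le)]
      positivity
    have hle : T ^ (4 * (H : ℝ)) / T ≤ 1 / T ^ γ := by
      rw [one_div, ← Real.rpow_neg hT.le, ← Real.rpow_sub_one hT.ne']
      refine Real.rpow_le_rpow_of_exponent_ge hT hT1.le ?_
      rcases le_total 1 (3 - 4 * (H : ℝ)) with h | h
      · rw [hγ, min_eq_left h]; linarith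
      · rw [hγ, min_eq_right h]; linarith
    have hinv : 1 ≤ 1 / T ^ γ := by
      rw [le_div_iff₀ hTγ, one_mul]
      exact Real.rpow_le_one hT.le hT1.le hγ0.le
    calc _ ≤ |1 / (2 * T) * startedEnergy (ouCov H) T| + |sigmaSq H| := abs_sub _ _
      _ = 1 / (2 * T) * startedEnergy (ouCov H) T + |sigmaSq H| := by
          rw [abs_of_nonneg (by positivity)]
      _ ≤ 1 / (2 * T) * (144 * T ^ (4 * (H : ℝ))) + |sigmaSq H| := by gcongr
      _ = 72 * (T ^ (4 * (H : ℝ)) / T) + |sigmaSq H| * 1 := by field_simp; ring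
      _ ≤ 72 * (1 / T ^ γ) + |sigmaSq H| * (1 / T ^ γ) := by gcongr
      _ = (72 + |sigmaSq H|) / T ^ γ := by ring
      _ ≤ _ := div_le_div_of_nonneg_right (by linarith) hTγ.le

end Main

end FBM

end

theorem mainTheorem2 (H : ℝ) (hH : H ∈ Set.Ioo (0 : ℝ) 1) (hH' : H ≠ 3 / 4) :
    (∀ T : ℝ, 0 < T → ∃! h : FBM.TensorSquare ⟨H, hH⟩ T, FBM.IsElement ⟨H, hH⟩ T (FBM.fT T) h) ∧
    (∀ T₀ : ℝ, 0 < T₀ → ∃ C : ℝ, 0 < C ∧ ∀ T : ℝ, T₀ ≤ T →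
      ∀ h : FBM.TensorSquare ⟨H, hH⟩ T, FBM.IsElement ⟨H, hH⟩ T (FBM.fT T) h →
        |1 / (2 * T) * ‖h‖ ^ 2 - FBM.sigmaSq H| ≤ C / T ^ (min 1 (3 - 4 * H))) ∧
    (H < 3 / 4 → ∃ C : ℝ, 0 < C ∧ ∀ T : ℝ, 0 < T →
      ∀ h : FBM.TensorSquare ⟨H, hH⟩ T, FBM.IsElement ⟨H, hH⟩ T (FBM.fT T) h →
        |1 / (2 * T) * ‖h‖ ^ 2 - FBM.sigmaSq H| ≤ C / T ^ (min 1 (3 - 4 * H))) := by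
  refine ⟨fun T hT => ⟨FBM.fTElement ⟨H, hH⟩ hT.le, FBM.isElement_fTElement ⟨H, hH⟩ hT.le,
    fun k hk => hk.unique ⟨H, hH⟩ (FBM.isElement_fTElement ⟨H, hH⟩ hT.le)⟩, fun T₀ hT₀ => ?_,
    fun h1 => ?_⟩
  · rcases lt_or_gt_of_ne hH' with h1 | h1
    · obtain ⟨C, hC, hb⟩ := FBM.exists_rate_all ⟨H, hH⟩ h1
      refine ⟨C, hC, fun T hT h hh => ?_⟩
      have hT0 : 0 < T := hT₀.trans_le hT
      rw [FBM.startedEnergy_ouCov_eq ⟨H, hH⟩ hT0.le hh]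
      exact hb T hT0
    · obtain ⟨C, hC, hb⟩ := FBM.exists_rate_of_gt h1 hH.2 hT₀
      refine ⟨C + 1, by linarith, fun T hT h hh => ?_⟩
      have hT0 : 0 < T := hT₀.trans_le hT
      rw [FBM.startedEnergy_ouCov_eq ⟨H, hH⟩ hT0.le hh]
      exact (hb T hT).trans
        (div_le_div_of_nonneg_right (by linarith) (Real.rpow_nonneg hT0.le _))
  · obtain ⟨C, hC, hb⟩ := FBM.exists_rate_all ⟨H, hH⟩ h1
    refine ⟨C, hC, fun T hT h hh => ?_⟩
    rw [FBM.startedEnergy_ouCov_eq ⟨H, hH⟩ hT.le hh]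
    exact hb T hT
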